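/- Let $(M,g)$ be an $n$-dimensional smooth Riemannian manifold with Levi-Civita connection $\nabla$, curvature tensor $R(X,Y,Z,U)=g(\nabla_X\nabla_YZ-\nabla_Y\nabla_XZ-\nabla_{[X,Y]}Z,\,U)$ and scalar curvature $\tau(p)=\sum_{i,j}R(e_i,e_j,e_j,e_i)$, where $(e_i)$ is an orthonormal basis of $T_pM$. Put $\pi(X,Y,Z,U)=g(Y,Z)g(X,U)-g(X,Z)g(Y,U)$ and, for a 1-form $\omega$, $$\Pi(\omega)(W,X,Y,Z,U)=2\omega(W)\pi(X,Y,Z,U)+\omega(X)\pi(W,Y,Z,U)+\omega(Y)\pi(X,W,Z,U)+\omega(Z)\pi(X,Y,W,U)+\omega(U)\pi(X,Y,Z,W).$$ For a 2-plane $E\subset T_pM$ with orthonormal basis $\{X,Y\}$ let $\varphi_E(Z)=(\nabla_ZR)(X,Y,Y,X)$ for $Z\in E$; this does not depend on the choice of the basis. Let $\eta$ be a smooth 1-form on $M$ of pointwise norm $1$, and let $\Delta(p)=\ker\eta_p$. Suppose that $(M,g)$ is directed by $\eta$: for every $p\in M$ and every 2-plane $E\subset T_pM$, if $E\not\subset\Delta(p)$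 then $\varphi_E=k(E,p)\,\eta|_E$ for some number $k(E,p)$ (the relative sectional curvature of $E$), and if $E\subset\Delta(p)$ then $\varphi_E=0$. Theorem 2.4. The number $k(E,p)$ does not depend on the 2-plane $E\not\subset\Delta(p)$, for each $p\in M$, if and only if there is a function $k:M\to\mathbb R$ with $\nabla R=\frac14\,k\,\Pi(\eta)$. More precisely, for every function $k:M\to\mathbb R$, one has $k(E,p)=k(p)$ for all $p\in M$ and all 2-planes $E\subset T_pM$ with $E\not\subset\Delta(p)$ if and only if $$\nabla R=\tfrac14\,k\,\Pi(\eta),$$ and in that case $\tau$ is differentiable and $$d\tau=\frac{(n-1)(n+2)}{2}\,k\,\eta.$$ -/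

import Mathlib

open Bundle VectorField FiberBundle
open scoped Manifold ContDiff

noncomputable section

set_option linter.unusedSectionVars false

namespace RiemannianGeometry

section LeviCivita

variable {E : Type*} [NormedAddCommGroup E] [NormedSpace ℝ E] [FiniteDimensional ℝ E]
  {H : Type*} [TopologicalSpace H] {I : ModelWithCorners ℝ E H}
  {M : Type*} [TopologicalSpace M] [ChartedSpace H M] [IsManifold I ∞ M]
  [RiemannianBundle (fun x : M ↦ TangentSpace I x)]
  [IsContMDiffRiemannianBundle I ∞ E (fun x : M ↦ TangentSpace I x)]

/-- The Koszul expression, whose value is `2 ⟪∇_X Y, Z⟫` for the Levi-Civita connection `∇`. -/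
def koszul (X Y Z : Π x : M, TangentSpace I x) (x : M) : ℝ :=
  mvfderiv I (fun y ↦ inner ℝ (Y y) (Z y)) x (X x)
    + mvfderiv I (fun y ↦ inner ℝ (Z y) (X y)) x (Y x)
    - mvfderiv I (fun y ↦ inner ℝ (X y) (Y y)) x (Z x)
    + inner ℝ (mlieBracket I X Y x) (Z x)
    - inner ℝ (mlieBracket I Y Z x) (X x)
    + inner ℝ (mlieBracket I Z X x) (Y x)

theorem mdifferentiableAt_inner {x : M} {Y Z : Π x : M, TangentSpace I x}
    (hY : MDiffAt (T% Y) x) (hZ : MDiffAt (T% Z) x) :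
    MDiffAt (fun y ↦ (inner ℝ (Y y) (Z y) : ℝ)) x :=
  MDifferentiableAt.inner_bundle (F := E) (E := fun x : M ↦ TangentSpace I x) hY hZ

theorem koszul_tensorial₁ {x : M} {Y Z : Π x : M, TangentSpace I x}
    (hY : MDiffAt (T% Y) x) (hZ : MDiffAt (T% Z) x) :
    TensorialAt I E (fun X ↦ koszul X Y Z x) x where
  smul {f X} hf hX := by
    have : CompleteSpace E := FiniteDimensional.complete ℝ E
    have h1 := mvfderiv_fun_mul hf (mdifferentiableAt_inner hX hY)
    have h2 := mvfderiv_fun_mul hf (mdifferentiableAt_inner hZ hX)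
    simp [koszul, mlieBracket_smul_left hf hX, mlieBracket_smul_right hf hX, inner_add_left,
      inner_smul_left, inner_smul_right, h1, h2]
    rw [real_inner_comm (X x) (Z x)]
    ring
  add {X X'} hX hX' := by
    have : CompleteSpace E := FiniteDimensional.complete ℝ E
    have h1 := mvfderiv_fun_add (mdifferentiableAt_inner hX hY) (mdifferentiableAt_inner hX' hY)
    have h2 := mvfderiv_fun_add (mdifferentiableAt_inner hZ hX) (mdifferentiableAt_inner hZ hX')
    simp [koszul, mlieBracket_add_left hX hX', mlieBracket_add_right hX hX', inner_add_left,
      inner_add_right, h1, h2]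
    ring

theorem koszul_tensorial₃ {x : M} {X Y : Π x : M, TangentSpace I x}
    (hX : MDiffAt (T% X) x) (hY : MDiffAt (T% Y) x) :
    TensorialAt I E (fun Z ↦ koszul X Y Z x) x where
  smul {f Z} hf hZ := by
    have : CompleteSpace E := FiniteDimensional.complete ℝ E
    have h1 := mvfderiv_fun_mul hf (mdifferentiableAt_inner hY hZ)
    have h2 := mvfderiv_fun_mul hf (mdifferentiableAt_inner hZ hX)
    simp [koszul, mlieBracket_smul_left hf hZ, mlieBracket_smul_right hf hZ, inner_add_left,
      inner_smul_left, inner_smul_right, h1, h2]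
    rw [real_inner_comm (Z x) (Y x)]
    ring
  add {Z Z'} hZ hZ' := by
    have : CompleteSpace E := FiniteDimensional.complete ℝ E
    have h1 := mvfderiv_fun_add (mdifferentiableAt_inner hY hZ) (mdifferentiableAt_inner hY hZ')
    have h2 := mvfderiv_fun_add (mdifferentiableAt_inner hZ hX) (mdifferentiableAt_inner hZ' hX)
    simp [koszul, mlieBracket_add_left hZ hZ', mlieBracket_add_right hZ hZ', inner_add_left,
      inner_add_right, h1, h2]
    ring

theorem koszul_add {x : M} {X Y Y' Z : Π x : M, TangentSpace I x}
    (hX : MDiffAt (T% X) x) (hY : MDiffAt (T% Y) x) (hY' : MDiffAt (T% Y') x)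
    (hZ : MDiffAt (T% Z) x) :
    koszul X (Y + Y') Z x = koszul X Y Z x + koszul X Y' Z x := by
  have : CompleteSpace E := FiniteDimensional.complete ℝ E
  have h1 := mvfderiv_fun_add (mdifferentiableAt_inner hY hZ) (mdifferentiableAt_inner hY' hZ)
  have h2 := mvfderiv_fun_add (mdifferentiableAt_inner hX hY) (mdifferentiableAt_inner hX hY')
  simp [koszul, mlieBracket_add_left hY hY', mlieBracket_add_right hY hY', inner_add_left,
      inner_add_right, h1, h2]
  ring

theorem koszul_smul {x : M} {f : M → ℝ} {X Y Z : Π x : M, TangentSpace I x}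
    (hf : MDiffAt f x) (hX : MDiffAt (T% X) x) (hY : MDiffAt (T% Y) x) (hZ : MDiffAt (T% Z) x) :
    koszul X (f • Y) Z x =
      f x * koszul X Y Z x + 2 * (mvfderiv I f x (X x) * inner ℝ (Y x) (Z x)) := by
  have : CompleteSpace E := FiniteDimensional.complete ℝ E
  have h1 := mvfderiv_fun_mul hf (mdifferentiableAt_inner hY hZ)
  have h2 := mvfderiv_fun_mul hf (mdifferentiableAt_inner hX hY)
  simp [koszul, mlieBracket_smul_left hf hY, mlieBracket_smul_right hf hY, inner_add_left,
      inner_smul_left, inner_smul_right, h1, h2]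
  rw [real_inner_comm (X x) (Y x)]
  ring

theorem koszul_torsion {x : M} (X Y Z : Π x : M, TangentSpace I x) :
    koszul X Y Z x - koszul Y X Z x = 2 * inner ℝ (mlieBracket I X Y x) (Z x) := by
  simp only [koszul, mlieBracket_swap_apply (V := Y) (W := X),
    mlieBracket_swap_apply (V := X) (W := Z), mlieBracket_swap_apply (V := Z) (W := Y),
    inner_neg_left, real_inner_comm]
  ring

theorem koszul_metric {x : M} (X Y Z : Π x : M, TangentSpace I x) :
    koszul X Y Z x + koszul X Z Y x =
      2 * mvfderiv I (fun y ↦ inner ℝ (Y y) (Z y)) x (X x) := by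
  simp only [koszul, mlieBracket_swap_apply (V := Y) (W := X),
    mlieBracket_swap_apply (V := X) (W := Z), mlieBracket_swap_apply (V := Z) (W := Y),
    inner_neg_left, real_inner_comm]
  ring

theorem exists_koszul_clm (Y : Π x : M, TangentSpace I x) (x : M) (hY : MDiffAt (T% Y) x) :
    ∃ A : TangentSpace I x →L[ℝ] TangentSpace I x, ∀ X Z : Π x : M, TangentSpace I x,
      MDiffAt (T% X) x → MDiffAt (T% Z) x →
      2 * inner ℝ (A (X x)) (Z x) = koszul X Y Z x := by
  have : FiniteDimensional ℝ (TangentSpace I x) := inferInstanceAs (FiniteDimensional ℝ E)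
  have : CompleteSpace (TangentSpace I x) := FiniteDimensional.complete ℝ _
  let B : TangentSpace I x →L[ℝ] TangentSpace I x →L[ℝ] ℝ :=
    TensorialAt.mkHom₂ (I := I) (F := E) (F' := E) (fun X Z ↦ koszul X Y Z x) x
      (fun Z hZ ↦ koszul_tensorial₁ hY hZ) (fun X hX ↦ koszul_tensorial₃ hX hY)
  have hB : ∀ X Z : Π x : M, TangentSpace I x, MDiffAt (T% X) x → MDiffAt (T% Z) x →
      B (X x) (Z x) = koszul X Y Z x := fun X Z hX hZ ↦
    TensorialAt.mkHom₂_apply (I := I) (F := E) (F' := E) (Φ := fun X Z ↦ koszul X Y Z x)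
      (fun Z hZ ↦ koszul_tensorial₁ hY hZ) (fun X hX ↦ koszul_tensorial₃ hX hY) hX hZ
  let L : TangentSpace I x →ₗ[ℝ] TangentSpace I x :=
    { toFun := fun v ↦ (2⁻¹ : ℝ) • (InnerProductSpace.toDual ℝ (TangentSpace I x)).symm (B v)
      map_add' := fun v w ↦ by simp
      map_smul' := fun c v ↦ by
        rw [map_smul, LinearIsometryEquiv.map_smulₛₗ, smul_comm]
        rfl }
  refine ⟨LinearMap.toContinuousLinearMap L, fun X Z hX hZ ↦ ?_⟩
  rw [← hB X Z hX hZ]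
  simp [L, inner_smul_left]

/-- A connection `∇` on the tangent bundle is a Levi-Civita connection if it is torsion free,
`∇_X Y - ∇_Y X = [X, Y]`, and compatible with the metric,
`X ⟪Y, Z⟫ = ⟪∇_X Y, Z⟫ + ⟪Y, ∇_X Z⟫`. Here `D Y x (X x)` stands for `(∇_X Y)(x)`. -/
structure IsLeviCivita (D : CovariantDerivative I E (fun x : M ↦ TangentSpace I x)) : Prop where
  torsion_free : D.torsion = 0
  metric : ∀ {x : M} {X Y Z : Π x : M, TangentSpace I x},
    MDiffAt (T% X) x → MDiffAt (T% Y) x → MDiffAt (T% Z) x →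
    mvfderiv I (fun y ↦ (inner ℝ (Y y) (Z y) : ℝ)) x (X x) =
      inner ℝ (D Y x (X x)) (Z x) + inner ℝ (Y x) (D Z x (X x))

open Classical in
theorem exists_leviCivita :
    ∃ D : CovariantDerivative I E (fun x : M ↦ TangentSpace I x),
      IsLeviCivita D := by
  have : CompleteSpace E := FiniteDimensional.complete ℝ E
  let cov : (Π x : M, TangentSpace I x) → (Π x : M, TangentSpace I x →L[ℝ] TangentSpace I x) :=
    fun Y x ↦ if h : MDiffAt (T% Y) x then (exists_koszul_clm Y x h).choose else 0
  have hcov : ∀ {x : M} {X Y Z : Π x : M, TangentSpace I x}, MDiffAt (T% X) x → MDiffAt (T% Y) x →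
      MDiffAt (T% Z) x → 2 * inner ℝ (cov Y x (X x)) (Z x) = koszul X Y Z x := by
    intro x X Y Z hX hY hZ
    simp only [cov, hY, dite_true]
    exact (exists_koszul_clm Y x hY).choose_spec X Z hX hZ
  have hcov' : ∀ {x : M} {Y : Π x : M, TangentSpace I x} (v w : TangentSpace I x),
      MDiffAt (T% Y) x → inner ℝ (cov Y x v) w = koszul (extend E v) Y (extend E w) x / 2 := by
    intro x Y v w hY
    have := hcov (mdifferentiableAt_extend I E v) hY (mdifferentiableAt_extend I E w)
    simp only [extend_apply_self] at this
    linarith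
  obtain ⟨D, hD⟩ : ∃ D : CovariantDerivative I E (fun x : M ↦ TangentSpace I x), D.toFun = cov :=
    ⟨{toFun := cov
      isCovariantDerivativeOnUniv :=
        { add := by
            intro Y Y' x hY hY' _
            ext1 v
            refine ext_inner_right ℝ fun w ↦ ?_
            rw [hcov' v w (mdifferentiableAt_add_section hY hY'), add_apply,
              inner_add_left, hcov' v w hY, hcov' v w hY',
              koszul_add (mdifferentiableAt_extend I E v) hY hY' (mdifferentiableAt_extend I E w)]
            ring
          leibniz := by
            intro Y f x hY hf _
            ext1 v
            refine ext_inner_right ℝ fun w ↦ ?_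
            rw [hcov' v w (hf.smul_section hY),
              koszul_smul hf (mdifferentiableAt_extend I E v) hY (mdifferentiableAt_extend I E w)]
            simp [inner_add_left, inner_smul_left, hcov' v w hY]
            ring } }, rfl⟩
  refine ⟨D, ?_, ?_⟩
  · rw [CovariantDerivative.torsion_eq_zero_iff]
    intro X Y x hX hY
    refine ext_inner_right ℝ fun w ↦ ?_
    have hw := mdifferentiableAt_extend I E w
    have h1 := hcov hX hY hw
    have h2 := hcov hY hX hw
    have h3 := koszul_torsion (x := x) X Y (extend E w)
    simp only [extend_apply_self] at h1 h2 h3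
    rw [hD, inner_sub_left]
    linarith
  · intro x X Y Z hX hY hZ
    have h1 := hcov hX hY hZ
    have h2 := hcov hX hZ hY
    have h3 := koszul_metric (x := x) X Y Z
    rw [hD, real_inner_comm (cov Z x (X x)) (Y x)]
    linarith

/-- The Levi-Civita connection `∇` of the Riemannian manifold `M`; `leviCivita I M Y x (X x)` is
`(∇_X Y)(x)`. By the Koszul formula its value is determined on every vector field `Y` at every point
`x` at which `Y` is differentiable. -/
def leviCivita (I : ModelWithCorners ℝ E H) (M : Type*) [TopologicalSpace M] [ChartedSpace H M]
    [IsManifold I ∞ M] [RiemannianBundle (fun x : M ↦ TangentSpace I x)]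
    [IsContMDiffRiemannianBundle I ∞ E (fun x : M ↦ TangentSpace I x)] :
    CovariantDerivative I E (fun x : M ↦ TangentSpace I x) :=
  (exists_leviCivita (I := I) (M := M)).choose

/-- The connection chosen above is torsion free and metric. -/
theorem isLeviCivita_leviCivita : IsLeviCivita (leviCivita I M) :=
  (exists_leviCivita (I := I) (M := M)).choose_spec

end LeviCivita

section Curvature

variable {E : Type*} [NormedAddCommGroup E] [NormedSpace ℝ E] [FiniteDimensional ℝ E]
  {H : Type*} [TopologicalSpace H] {I : ModelWithCorners ℝ E H}
  {M : Type*} [TopologicalSpace M] [ChartedSpace H M] [IsManifold I ∞ M]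
  [RiemannianBundle (fun x : M ↦ TangentSpace I x)]
  [IsContMDiffRiemannianBundle I ∞ E (fun x : M ↦ TangentSpace I x)]

instance finiteDimensional_tangentSpace (x : M) : FiniteDimensional ℝ (TangentSpace I x) :=
  inferInstanceAs (FiniteDimensional ℝ E)

/-- The vector field `∇_X Y`. -/
def nabla (X Y : Π x : M, TangentSpace I x) (x : M) : TangentSpace I x :=
  leviCivita I M Y x (X x)

/-- The vector field `R(X, Y) Z = ∇_X ∇_Y Z - ∇_Y ∇_X Z - ∇_[X, Y] Z`. -/
def curvatureOperator (X Y Z : Π x : M, TangentSpace I x) (x : M) : TangentSpace I x :=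
  nabla X (nabla Y Z) x - nabla Y (nabla X Z) x - nabla (mlieBracket I X Y) Z x

/-- The function `R(X, Y, Z, U) = g(R(X, Y) Z, U)` for vector fields `X, Y, Z, U`. -/
def curvatureField (X Y Z U : Π x : M, TangentSpace I x) (x : M) : ℝ :=
  inner ℝ (curvatureOperator X Y Z x) (U x)

/-- The function `(∇_W R)(X, Y, Z, U)` for vector fields `W, X, Y, Z, U`, that is,
`W (R(X,Y,Z,U)) - R(∇_W X,Y,Z,U) - R(X,∇_W Y,Z,U) - R(X,Y,∇_W Z,U) - R(X,Y,Z,∇_W U)`. -/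
def nablaCurvatureField (W X Y Z U : Π x : M, TangentSpace I x) (x : M) : ℝ :=
  mvfderiv I (curvatureField X Y Z U) x (W x)
    - curvatureField (nabla W X) Y Z U x
    - curvatureField X (nabla W Y) Z U x
    - curvatureField X Y (nabla W Z) U x
    - curvatureField X Y Z (nabla W U) x

/-- The curvature tensor `R(x, y, z, u)` on tangent vectors at `p`. As `R` is a tensor, the smooth
local extensions of the vectors used to evaluate it do not matter. -/
def curvatureTensor (p : M) (x y z u : TangentSpace I p) : ℝ :=
  curvatureField (I := I) (extend E x) (extend E y) (extend E z) (extend E u) p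

/-- The tensor `(∇_w R)(x, y, z, u)` on tangent vectors at `p`. As `∇R` is a tensor, the smooth
local extensions of the vectors used to evaluate it do not matter. -/
def nablaCurvature (p : M) (w x y z u : TangentSpace I p) : ℝ :=
  nablaCurvatureField (I := I) (extend E w) (extend E x) (extend E y) (extend E z) (extend E u) p

variable (I) in
/-- The scalar curvature `τ(p) = ∑ i j, R(e i, e j, e j, e i)`, with `e` an orthonormal basis of
the tangent space at `p`. -/
def scalarCurvature (p : M) : ℝ :=
  ∑ i, ∑ j, curvatureTensor p
    (stdOrthonormalBasis ℝ (TangentSpace I p) i) (stdOrthonormalBasis ℝ (TangentSpace I p) j)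
    (stdOrthonormalBasis ℝ (TangentSpace I p) j) (stdOrthonormalBasis ℝ (TangentSpace I p) i)

/-- `π(x, y, z, u) = g(y, z) g(x, u) - g(x, z) g(y, u)`. -/
def metricPi {p : M} (x y z u : TangentSpace I p) : ℝ :=
  inner ℝ y z * inner ℝ x u - inner ℝ x z * inner ℝ y u

/-- The tensor `Π(α)` of a covector `α`. -/
def tensorPi {p : M} (α : TangentSpace I p →L[ℝ] ℝ) (w x y z u : TangentSpace I p) : ℝ :=
  2 * α w * metricPi x y z u + α x * metricPi w y z u + α y * metricPi x w z u
    + α z * metricPi x y w u + α u * metricPi x y z w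

/-- The sectional 1-form `φ_P(Z) = (∇_Z R)(X, Y, Y, X)`, `Z ∈ P`, of a 2-plane `P` in the tangent
space at `p`, where `X, Y` is an orthonormal basis of `P` (whose choice does not matter). -/
def sectionalOneForm {p : M} (P : Submodule ℝ (TangentSpace I p)) (hP : Module.finrank ℝ P = 2)
    (Z : P) : ℝ :=
  let b : OrthonormalBasis (Fin 2) ℝ P := (stdOrthonormalBasis ℝ P).reindex (finCongr hP)
  nablaCurvature p (Z : TangentSpace I p) (b 0) (b 1) (b 1) (b 0)

/-- The hyperplane `Δ(p) = {X | η(X) = 0}` of the tangent space at `p`. -/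
def distribution (η : Π p : M, TangentSpace I p →L[ℝ] ℝ) (p : M) :
    Submodule ℝ (TangentSpace I p) :=
  LinearMap.ker (η p : TangentSpace I p →ₗ[ℝ] ℝ)

/-- `φ_P = c η|_P`. For a 2-plane `P ⊄ Δ(p)` at most one `c` satisfies this; it is the relative
sectional curvature `k(P, p)`. -/
def IsRelativeSectionalCurvature (η : Π p : M, TangentSpace I p →L[ℝ] ℝ) {p : M}
    (P : Submodule ℝ (TangentSpace I p)) (hP : Module.finrank ℝ P = 2) (c : ℝ) : Prop :=
  ∀ Z : P, sectionalOneForm P hP Z = c * η p Z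

/-- The Riemannian manifold `M` is directed by the (smooth) unit 1-form `η`. -/
structure IsDirectedBy (η : Π p : M, TangentSpace I p →L[ℝ] ℝ) : Prop where
  contMDiff : ContMDiff I (I.prod 𝓘(ℝ, E →L[ℝ] ℝ)) ∞
    (fun p ↦ TotalSpace.mk' (E →L[ℝ] ℝ) (E := fun p : M ↦ TangentSpace I p →L[ℝ] ℝ) p (η p))
  norm_eq_one : ∀ p, ‖η p‖ = 1
  exists_relativeSectionalCurvature : ∀ (p : M) (P : Submodule ℝ (TangentSpace I p))
    (hP : Module.finrank ℝ P = 2), ¬ P ≤ distribution η p →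
      ∃ c : ℝ, IsRelativeSectionalCurvature η P hP c
  sectionalOneForm_eq_zero : ∀ (p : M) (P : Submodule ℝ (TangentSpace I p))
    (hP : Module.finrank ℝ P = 2), P ≤ distribution η p → ∀ Z : P, sectionalOneForm P hP Z = 0

/-- The relative sectional curvatures `k(P, p)` of the 2-planes `P ⊄ Δ(p)` at a point `p` do not
depend on `P`. -/
def IsPointwiseConstantRelativeCurvature (η : Π p : M, TangentSpace I p →L[ℝ] ℝ) : Prop :=
  ∀ (p : M) (P P' : Submodule ℝ (TangentSpace I p))
    (hP : Module.finrank ℝ P = 2) (hP' : Module.finrank ℝ P' = 2) (c c' : ℝ),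
    ¬ P ≤ distribution η p → ¬ P' ≤ distribution η p →
    IsRelativeSectionalCurvature η P hP c → IsRelativeSectionalCurvature η P' hP' c' → c = c'

/-- Every 2-plane `P ⊄ Δ(p)` at every point `p` has relative sectional curvature `k(p)`. -/
def HasPointwiseConstantRelativeCurvature (η : Π p : M, TangentSpace I p →L[ℝ] ℝ) (k : M → ℝ) : Prop :=
  ∀ (p : M) (P : Submodule ℝ (TangentSpace I p)) (hP : Module.finrank ℝ P = 2),
    ¬ P ≤ distribution η p → IsRelativeSectionalCurvature η P hP (k p)

/-- The tensor identity `∇R = (1/4) k Π(η)` on `M`. -/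
def NablaCurvatureEq (η : Π p : M, TangentSpace I p →L[ℝ] ℝ) (k : M → ℝ) : Prop :=
  ∀ (p : M) (w x y z u : TangentSpace I p),
    nablaCurvature p w x y z u = 1 / 4 * k p * tensorPi (η p) w x y z u

end Curvature

end RiemannianGeometry

end

open RiemannianGeometry

open scoped Topology

/-! The core is algebraic. Consider forms T(w; x, y, z, u) for which each T(w; ·) has the symmetries
of a curvature tensor and T satisfies the second Bianchi identity. Both ∇R and Π(η) are of this
kind, hence so is D = ∇R - (k/4) Π(η) at each point. Such a form vanishes as soon as T(x; x, y, y,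
x) = 0 for all x, y (`IsNablaCurvatureLike.eq_zero`).

If X, Y is an orthonormal basis of a plane P and Z ∈ P, then Π(η)(Z, X, Y, Y, X) = 4 η(Z)
(`tensorPi_orthonormalBasis_plane`), so φ_P = k η|_P says exactly that D(Z; X, Y, Y, X) = 0 on P.
Planes inside Δ(p) satisfy this as well, since there both φ_P and η|_P vanish. Changing the basis of
P multiplies D(Z; X, Y, Y, X) by a squared determinant, so D(x; x, y, y, x) = 0 for all x, y, and D
= 0. The converse is the same evaluation of Π(η).

For the scalar curvature, taking the trace commutes with ∇ (`smoothNear_scalarCurvature`), and the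
double trace of Π(η) is 2 (n - 1) (n + 2) η (`sum_tensorPi`); the factor k/4 gives the constant.

The remaining work shows that ∇R, defined through extensions of vectors to fields, is tensorial and
has the required symmetries. These come from torsion-freeness, compatibility with the metric and the
Jacobi identity for the Lie bracket. -/

namespace RiemannianGeometry

set_option linter.unusedSectionVars false

/-! ### Functions and vector fields that are smooth near a point -/

section SmoothGerms

variable {E : Type*} [NormedAddCommGroup E] [NormedSpace ℝ E]
  {H : Type*} [TopologicalSpace H] {I : ModelWithCorners ℝ E H}
  {M : Type*} [TopologicalSpace M] [ChartedSpace H M] {p : M}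

variable (I) in
/-- The function `f` is smooth on a neighbourhood of `p`. -/
def SmoothNear (f : M → ℝ) (p : M) : Prop :=
  ∀ᶠ q in 𝓝 p, ContMDiffAt I 𝓘(ℝ, ℝ) ∞ f q

namespace SmoothNear

theorem mdifferentiableAt {f : M → ℝ} (hf : SmoothNear I f p) : MDiffAt f p :=
  hf.self_of_nhds.mdifferentiableAt (by simp)

/-- Pointwise identities are differentiated later on, so they are needed at all points near `p`;
hypotheses that hold on a neighbourhood pass to these points. -/
theorem eventually {f : M → ℝ} (hf : SmoothNear I f p) : ∀ᶠ q in 𝓝 p, SmoothNear I f q :=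
  eventually_eventually_nhds.2 hf

theorem congr {f g : M → ℝ} (hf : SmoothNear I f p) (h : f =ᶠ[𝓝 p] g) : SmoothNear I g p := by
  filter_upwards [hf, eventually_eventually_nhds.2 h] with q hq hfg
  exact hq.congr_of_eventuallyEq (Filter.EventuallyEq.symm hfg)

theorem const (c : ℝ) : SmoothNear I (fun _ : M ↦ c) p :=
  .of_forall fun _ ↦ contMDiffAt_const

theorem add {f g : M → ℝ} (hf : SmoothNear I f p) (hg : SmoothNear I g p) :
    SmoothNear I (fun q ↦ f q + g q) p := by
  filter_upwards [hf, hg] with q h1 h2 using h1.add h2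

theorem sub {f g : M → ℝ} (hf : SmoothNear I f p) (hg : SmoothNear I g p) :
    SmoothNear I (fun q ↦ f q - g q) p := by
  filter_upwards [hf, hg] with q h1 h2 using h1.sub h2

theorem mul {f g : M → ℝ} (hf : SmoothNear I f p) (hg : SmoothNear I g p) :
    SmoothNear I (fun q ↦ f q * g q) p := by
  filter_upwards [hf, hg] with q h1 h2 using h1.mul h2

theorem sum {ι : Type*} {s : Finset ι} {f : ι → M → ℝ} (hf : ∀ i ∈ s, SmoothNear I (f i) p) :
    SmoothNear I (fun q ↦ ∑ i ∈ s, f i q) p := by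
  classical
  induction s using Finset.induction_on with
  | empty => simpa using const 0
  | insert a s ha ih =>
    simp only [Finset.sum_insert ha]
    exact (hf a (by simp)).add (ih fun i hi ↦ hf i (by simp [hi]))

theorem comp_contDiffAt {f : M → ℝ} {g : ℝ → ℝ} (hf : SmoothNear I f p)
    (hg : ∀ᶠ q in 𝓝 p, ContDiffAt ℝ ∞ g (f q)) : SmoothNear I (fun q ↦ g (f q)) p := by
  filter_upwards [hf, hg] with q h1 h2
  exact h2.contMDiffAt.comp q h1

theorem continuousAt {f : M → ℝ} (hf : SmoothNear I f p) : ContinuousAt f p :=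
  hf.self_of_nhds.continuousAt

theorem inv {f : M → ℝ} (hf : SmoothNear I f p) (h0 : f p ≠ 0) :
    SmoothNear I (fun q ↦ (f q)⁻¹) p :=
  hf.comp_contDiffAt <| (hf.continuousAt.eventually_ne h0).mono fun _ hq ↦ contDiffAt_inv ℝ hq

theorem sqrt {f : M → ℝ} (hf : SmoothNear I f p) (h0 : f p ≠ 0) :
    SmoothNear I (fun q ↦ √(f q)) p :=
  hf.comp_contDiffAt <|
    (hf.continuousAt.eventually_ne h0).mono fun _ hq ↦ Real.contDiffAt_sqrt hq

end SmoothNear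

variable [IsManifold I ∞ M]

/-- The vector field `X` is smooth on a neighbourhood of `p`. -/
def SmoothFieldNear (X : Π x : M, TangentSpace I x) (p : M) : Prop :=
  ∀ᶠ q in 𝓝 p, ContMDiffAt I I.tangent ∞ (fun x ↦ (⟨x, X x⟩ : TangentBundle I M)) q

namespace SmoothFieldNear

variable {X Y : Π x : M, TangentSpace I x} {f : M → ℝ}

theorem contMDiffAt (hX : SmoothFieldNear X p) :
    ContMDiffAt I I.tangent ∞ (fun x ↦ (⟨x, X x⟩ : TangentBundle I M)) p :=
  hX.self_of_nhds

theorem mdifferentiableAt (hX : SmoothFieldNear X p) : MDiffAt (T% X) p :=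
  hX.contMDiffAt.mdifferentiableAt (by simp)

theorem eventually (hX : SmoothFieldNear X p) : ∀ᶠ q in 𝓝 p, SmoothFieldNear X q :=
  eventually_eventually_nhds.2 hX

theorem congr (hX : SmoothFieldNear X p) (h : ∀ᶠ q in 𝓝 p, X q = Y q) :
    SmoothFieldNear Y p := by
  filter_upwards [hX, eventually_eventually_nhds.2 h] with q hq hXY
  exact hq.congr_of_eventuallyEq (hXY.mono fun x hx ↦ by simp [hx])

theorem add (hX : SmoothFieldNear X p) (hY : SmoothFieldNear Y p) : SmoothFieldNear (X + Y) p := by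
  filter_upwards [hX, hY] with q h1 h2
  exact ContMDiffAt.add_section (F := E) h1 h2

theorem sub (hX : SmoothFieldNear X p) (hY : SmoothFieldNear Y p) : SmoothFieldNear (X - Y) p := by
  filter_upwards [hX, hY] with q h1 h2
  exact ContMDiffAt.sub_section (F := E) h1 h2

theorem smul (hf : SmoothNear I f p) (hX : SmoothFieldNear X p) : SmoothFieldNear (f • X) p := by
  filter_upwards [hf, hX] with q h1 h2
  exact ContMDiffAt.smul_section (F := E) h1 h2

theorem sum {ι : Type*} {s : Finset ι} {X : ι → Π x : M, TangentSpace I x}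
    (hX : ∀ i ∈ s, SmoothFieldNear (X i) p) : SmoothFieldNear (fun q ↦ ∑ i ∈ s, X i q) p := by
  have h : ∀ᶠ q in 𝓝 p, ∀ i ∈ s,
      ContMDiffAt I I.tangent ∞ (fun x ↦ (⟨x, X i x⟩ : TangentBundle I M)) q :=
    (Filter.eventually_all_finset s).2 hX
  filter_upwards [h] with q hq
  exact ContMDiffAt.sum_section (F := E) hq

theorem extend (v : TangentSpace I p) : SmoothFieldNear (FiberBundle.extend E v) p := by
  obtain ⟨s, hs, h⟩ := exists_contMDiffOn_extend I E (k := ∞) v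
  filter_upwards [eventually_mem_nhds_iff.2 hs] with q hq
  exact h.contMDiffAt hq

theorem mlieBracket [CompleteSpace E] (hX : SmoothFieldNear X p) (hY : SmoothFieldNear Y p) :
    SmoothFieldNear (mlieBracket I X Y) p := by
  have : IsManifold I (((⊤ : ℕ∞) : WithTop ℕ∞) + 1) M := by
    simpa using (inferInstance : IsManifold I ∞ M)
  have : IsManifold I (minSmoothness ℝ 2) M := by
    simpa using (inferInstance : IsManifold I 2 M)
  filter_upwards [hX, hY] with q h1 h2
  exact ContMDiffAt.mlieBracket_vectorField (m := ⊤) (n := ⊤) h1 h2 (by simp)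

end SmoothFieldNear

theorem mlieBracket_jacobi [CompleteSpace E] {X Y Z : Π x : M, TangentSpace I x}
    (hX : SmoothFieldNear X p) (hY : SmoothFieldNear Y p) (hZ : SmoothFieldNear Z p) :
    mlieBracket I X (mlieBracket I Y Z) p =
      mlieBracket I (mlieBracket I X Y) Z p + mlieBracket I Y (mlieBracket I X Z) p := by
  have : IsManifold I (minSmoothness ℝ 3) M := by
    rw [minSmoothness_of_isRCLikeNormedField]
    exact IsManifold.of_le (n := ∞) ENat.LEInfty.out
  have h {X : Π x : M, TangentSpace I x} (hX : SmoothFieldNear X p) :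
      ContMDiffAt I I.tangent (minSmoothness ℝ 2)
        (fun x ↦ (⟨x, X x⟩ : TangentBundle I M)) p := by
    rw [minSmoothness_of_isRCLikeNormedField]
    exact hX.contMDiffAt.of_le ENat.LEInfty.out
  exact leibniz_identity_mlieBracket_apply (h hX) (h hY) (h hZ)

end SmoothGerms

/-! ### Functionals linear over smooth functions depend only on the value at the point -/

section Tensoriality

variable {E : Type*} [NormedAddCommGroup E] [NormedSpace ℝ E]
  {H : Type*} [TopologicalSpace H] {I : ModelWithCorners ℝ E H}
  {M : Type*} [TopologicalSpace M] [ChartedSpace H M] [IsManifold I ∞ M] {p : M}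

/-- The functional `Φ` on vector fields is linear over the functions that are smooth near `p`. -/
structure SmoothTensorialAt (Φ : (Π x : M, TangentSpace I x) → ℝ) (p : M) : Prop where
  smul : ∀ {f : M → ℝ} {X : Π x : M, TangentSpace I x}, SmoothNear I f p → SmoothFieldNear X p →
    Φ (f • X) = f p * Φ X
  add : ∀ {X Y : Π x : M, TangentSpace I x}, SmoothFieldNear X p → SmoothFieldNear Y p →
    Φ (X + Y) = Φ X + Φ Y

namespace SmoothTensorialAt

variable {Φ : (Π x : M, TangentSpace I x) → ℝ} {X Y : Π x : M, TangentSpace I x}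

theorem congr_of_eventuallyEq (hΦ : SmoothTensorialAt Φ p) (hX : SmoothFieldNear X p)
    (hY : SmoothFieldNear Y p) (h : ∀ᶠ q in 𝓝 p, X q = Y q) : Φ X = Φ Y := by
  classical
  -- Only smoothness near `p` is asked of a multiplier, so the indicator of the coincidence set
  -- replaces a bump function: it is 1 near `p`, and ψX = ψY everywhere.
  let ψ : M → ℝ := fun q ↦ if X q = Y q then 1 else 0
  have hψp : ψ p = 1 := by simp [ψ, h.self_of_nhds]
  have hψ : SmoothNear I ψ p :=
    (SmoothNear.const 1).congr (h.mono fun q hq ↦ by simp [ψ, hq])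
  have hXY : ψ • X = ψ • Y := by
    funext q
    by_cases hq : X q = Y q <;> simp [ψ, hq]
  have h1 := hΦ.smul hψ hX
  have h2 := hΦ.smul hψ hY
  rw [hψp, one_mul] at h1 h2
  rw [← h1, ← h2, hXY]

theorem zero (hΦ : SmoothTensorialAt Φ p) : Φ 0 = 0 := by
  have h0 : SmoothFieldNear (0 : Π x : M, TangentSpace I x) p := by
    simpa using! SmoothFieldNear.sum (p := p) (s := (∅ : Finset ℕ))
      (X := fun _ x ↦ (0 : TangentSpace I x)) (by simp)
  simpa using! hΦ.smul (SmoothNear.const 0) h0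

theorem sum (hΦ : SmoothTensorialAt Φ p) {ι : Type*} {s : Finset ι}
    {X : ι → Π x : M, TangentSpace I x} (hX : ∀ i ∈ s, SmoothFieldNear (X i) p) :
    Φ (fun q ↦ ∑ i ∈ s, X i q) = ∑ i ∈ s, Φ (X i) := by
  classical
  induction s using Finset.induction_on with
  | empty => simpa using! hΦ.zero
  | insert a s ha ih =>
    simp only [Finset.mem_insert, forall_eq_or_imp] at hX
    simp only [Finset.sum_insert ha, ← ih hX.2]
    exact hΦ.add hX.1 (.sum hX.2)

/-- Expanding the field in a local frame expresses `Φ X` through the frame coefficients of `X` at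
`p` alone. -/
theorem pointwise [FiniteDimensional ℝ E] (hΦ : SmoothTensorialAt Φ p) (hX : SmoothFieldNear X p)
    (hY : SmoothFieldNear Y p) (h : X p = Y p) : Φ X = Φ Y := by
  let t := trivializationAt E (fun x : M ↦ TangentSpace I x) p
  have hp : p ∈ t.baseSet := FiberBundle.mem_baseSet_trivializationAt E _ p
  let b := Module.Basis.ofVectorSpace ℝ E
  let s := t.localFrame b
  let c := t.localFrameCoeff I b
  have hbase : ∀ᶠ q in 𝓝 p, q ∈ t.baseSet := t.open_baseSet.mem_nhds hp
  have hs (i) : SmoothFieldNear (s i) p := by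
    filter_upwards [hbase] with q hq
    exact contMDiffAt_localFrame_of_mem ∞ _ b i hq
  have hc {X : Π x : M, TangentSpace I x} (hX : SmoothFieldNear X p) (i) :
      SmoothNear I (LinearMap.piApply (c i) X) p := by
    filter_upwards [hbase, hX] with q hq hXq
    exact contMDiffAt_localFrameCoeff b hq hXq i
  have key {X : Π x : M, TangentSpace I x} (hX : SmoothFieldNear X p) :
      Φ X = ∑ i, c i p (X p) * Φ (s i) := by
    have hsm i : SmoothFieldNear (LinearMap.piApply (c i) X • s i) p := (hs i).smul (hc hX i)
    calc Φ X = Φ (fun q ↦ ∑ i, (LinearMap.piApply (c i) X • s i) q) :=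
          hΦ.congr_of_eventuallyEq hX (.sum fun i _ ↦ hsm i)
            (t.eventually_eq_localFrame_sum_coeff_smul b hp)
      _ = ∑ i, Φ (LinearMap.piApply (c i) X • s i) := hΦ.sum fun i _ ↦ hsm i
      _ = _ := Finset.sum_congr rfl fun i _ ↦ hΦ.smul (hc hX i) (hs i)
  rw [key hX, key hY, h]

end SmoothTensorialAt

end Tensoriality

/-! ### Derivatives along fields, orthonormal frames and smoothness of the connection -/

section Connection

variable {E : Type*} [NormedAddCommGroup E] [NormedSpace ℝ E] [FiniteDimensional ℝ E]
  {H : Type*} [TopologicalSpace H] {I : ModelWithCorners ℝ E H}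
  {M : Type*} [TopologicalSpace M] [ChartedSpace H M] [IsManifold I ∞ M]
  [RiemannianBundle (fun x : M ↦ TangentSpace I x)]
  [IsContMDiffRiemannianBundle I ∞ E (fun x : M ↦ TangentSpace I x)]
  {p : M} {X Y Z : Π x : M, TangentSpace I x} {f : M → ℝ}

theorem SmoothFieldNear.inner (hX : SmoothFieldNear X p) (hY : SmoothFieldNear Y p) :
    SmoothNear I (fun q ↦ (inner ℝ (X q) (Y q) : ℝ)) p := by
  filter_upwards [hX, hY] with q h1 h2
  exact ContMDiffAt.inner_bundle (F := E) (E := fun x : M ↦ TangentSpace I x) h1 h2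

theorem exists_smoothFieldNear_ne_zero [Nontrivial E] (p : M) :
    ∃ Z : Π x : M, TangentSpace I x, SmoothFieldNear Z p ∧ Z p ≠ 0 := by
  obtain ⟨v, hv⟩ := exists_ne (0 : E)
  exact ⟨FiberBundle.extend E (x := p) (show TangentSpace I p from v), .extend _, by
    rw [extend_apply_self]
    exact hv⟩

theorem tangentSpace_eq_zero [Subsingleton E] (v : TangentSpace I p) : v = 0 :=
  Subsingleton.elim (α := E) v 0

/-- The Leibniz rule [X, fZ] - f[X, Z] = (Xf) Z reduces this to smoothness of brackets: pairing with
a field Z that is nonzero at `p` and dividing by ⟨Z, Z⟩ isolates Xf. -/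
theorem SmoothNear.mvfderiv_apply (hf : SmoothNear I f p) (hX : SmoothFieldNear X p) :
    SmoothNear I (fun q ↦ mvfderiv I f q (X q)) p := by
  have : CompleteSpace E := FiniteDimensional.complete ℝ E
  rcases subsingleton_or_nontrivial E with hE | hE
  · exact (SmoothNear.const 0).congr (.of_forall fun q ↦ by
      simp [tangentSpace_eq_zero (X q)])
  obtain ⟨Z, hZ, hZp⟩ := exists_smoothFieldNear_ne_zero (I := I) p
  have hZZ : (inner ℝ (Z p) (Z p) : ℝ) ≠ 0 := by simpa using hZp
  have h := (((hX.mlieBracket (hZ.smul hf)).sub ((hX.mlieBracket hZ).smul hf)).inner hZ).mul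
    ((hZ.inner hZ).inv hZZ)
  refine h.congr ?_
  filter_upwards [hf.eventually, hZ.eventually, (hZ.inner hZ).continuousAt.eventually_ne hZZ]
    with q hfq hZq hne
  simp only [Pi.sub_apply, Pi.smul_apply', mlieBracket_smul_right hfq.mdifferentiableAt
    hZq.mdifferentiableAt, add_sub_cancel_right, inner_smul_left]
  field_simp
  simp

theorem mvfderiv_congr {f g : M → ℝ} (h : f =ᶠ[𝓝 p] g) : mvfderiv I f p = mvfderiv I g p := by
  ext v
  simp only [mvfderiv, h.mfderiv_eq]
  rfl

/-- The Jacobi identity for X, Y and fZ, expanded by the Leibniz rule, minus f times the one for X,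
Y and Z, leaves the claim multiplied by Z, which is nonzero at `p`. -/
theorem mvfderiv_mlieBracket_apply (hf : SmoothNear I f p) (hX : SmoothFieldNear X p)
    (hY : SmoothFieldNear Y p) :
    mvfderiv I f p (mlieBracket I X Y p) =
      mvfderiv I (fun q ↦ mvfderiv I f q (Y q)) p (X p) -
        mvfderiv I (fun q ↦ mvfderiv I f q (X q)) p (Y p) := by
  have : CompleteSpace E := FiniteDimensional.complete ℝ E
  rcases subsingleton_or_nontrivial E with hE | hE
  · simp [tangentSpace_eq_zero (X p), tangentSpace_eq_zero (Y p),
      tangentSpace_eq_zero (mlieBracket I X Y p)]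
  obtain ⟨Z, hZ, hZp⟩ := exists_smoothFieldNear_ne_zero (I := I) p
  have expand {X Y : Π x : M, TangentSpace I x} (hX : SmoothFieldNear X p)
      (hY : SmoothFieldNear Y p) :
      mlieBracket I X (mlieBracket I Y (f • Z)) p =
        mvfderiv I (fun q ↦ mvfderiv I f q (Y q)) p (X p) • Z p
          + mvfderiv I f p (Y p) • mlieBracket I X Z p
          + (mvfderiv I f p (X p) • mlieBracket I Y Z p
            + f p • mlieBracket I X (mlieBracket I Y Z) p) := by
    have h1 : mlieBracket I Y (f • Z) =ᶠ[𝓝 p]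
        (fun q ↦ mvfderiv I f q (Y q)) • Z + f • mlieBracket I Y Z := by
      filter_upwards [hf.eventually, hZ.eventually] with q hfq hZq
      exact mlieBracket_smul_right hfq.mdifferentiableAt hZq.mdifferentiableAt
    have hYf := hf.mvfderiv_apply hY
    have hYZ := hY.mlieBracket hZ
    rw [Filter.EventuallyEq.rfl.mlieBracket_vectorField_eq h1,
      mlieBracket_add_right (hZ.smul hYf).mdifferentiableAt (hYZ.smul hf).mdifferentiableAt,
      mlieBracket_smul_right hYf.mdifferentiableAt hZ.mdifferentiableAt,
      mlieBracket_smul_right hf.mdifferentiableAt hYZ.mdifferentiableAt]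
  have hj := mlieBracket_jacobi hX hY (hZ.smul hf)
  rw [expand hX hY, expand hY hX, mlieBracket_smul_right hf.mdifferentiableAt hZ.mdifferentiableAt,
    mlieBracket_jacobi hX hY hZ] at hj
  have h0 : (mvfderiv I f p (mlieBracket I X Y p) -
      (mvfderiv I (fun q ↦ mvfderiv I f q (Y q)) p (X p) -
        mvfderiv I (fun q ↦ mvfderiv I f q (X q)) p (Y p))) • Z p = 0 := by
    rw [← sub_eq_zero] at hj
    rw [← neg_eq_zero, ← hj]
    module
  exact sub_eq_zero.1 ((smul_eq_zero.1 h0).resolve_right hZp)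

-- Gram–Schmidt applied to a local frame. By induction each step involves only inner products of
-- smooth fields and inverses of squared norms, which are nonzero at `p` by linear independence.
variable (I) in
theorem exists_orthonormal_frame (p : M) :
    ∃ e : Fin (Module.finrank ℝ E) → Π x : M, TangentSpace I x,
      (∀ i, SmoothFieldNear (e i) p) ∧ ∀ᶠ q in 𝓝 p, Orthonormal ℝ (fun i ↦ e i q) := by
  let t := trivializationAt E (fun x : M ↦ TangentSpace I x) p
  have hp : p ∈ t.baseSet := FiberBundle.mem_baseSet_trivializationAt E _ p
  let s := t.localFrame (Module.finBasis ℝ E)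
  have hs (i) : SmoothFieldNear (s i) p := by
    filter_upwards [t.open_baseSet.mem_nhds hp] with q hq
    exact contMDiffAt_localFrame_of_mem ∞ _ _ i hq
  have hli {q : M} (hq : q ∈ t.baseSet) : LinearIndependent ℝ (fun i ↦ s i q) :=
    (t.isLocalFrameOn_localFrame_baseSet I ∞ (Module.finBasis ℝ E)).linearIndependent hq
  have hg (i) : SmoothFieldNear
      (fun q ↦ InnerProductSpace.gramSchmidt ℝ (fun j ↦ s j q) i) p := by
    induction i using WellFoundedLT.induction with
    | ind i ih =>
      have h := (hs i).sub (.sum (s := Finset.Iio i)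
        (X := fun j ↦
          (fun q ↦ (inner ℝ (InnerProductSpace.gramSchmidt ℝ (fun k ↦ s k q) j) (s i q) : ℝ)
            * (inner ℝ (InnerProductSpace.gramSchmidt ℝ (fun k ↦ s k q) j)
              (InnerProductSpace.gramSchmidt ℝ (fun k ↦ s k q) j) : ℝ)⁻¹) •
          (fun q ↦ InnerProductSpace.gramSchmidt ℝ (fun k ↦ s k q) j)) fun j hj ↦ by
        have hj' := ih j (Finset.mem_Iio.1 hj)
        refine hj'.smul ((hj'.inner (hs i)).mul ((hj'.inner hj').inv ?_))
        simpa using InnerProductSpace.gramSchmidt_ne_zero j (hli hp))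
      refine h.congr (.of_forall fun q ↦ ?_)
      rw [InnerProductSpace.gramSchmidt_def]
      simp [Submodule.starProjection_singleton, div_eq_mul_inv]
  refine ⟨fun i q ↦ InnerProductSpace.gramSchmidtNormed ℝ (fun j ↦ s j q) i, fun i ↦ ?_, ?_⟩
  · have hne : (inner ℝ (InnerProductSpace.gramSchmidt ℝ (fun j ↦ s j p) i)
        (InnerProductSpace.gramSchmidt ℝ (fun j ↦ s j p) i) : ℝ) ≠ 0 := by
      simpa using InnerProductSpace.gramSchmidt_ne_zero i (hli hp)
    have h := (hg i).smul ((((hg i).inner (hg i)).sqrt hne).inv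
      (by rw [← norm_eq_sqrt_real_inner]
          simpa using InnerProductSpace.gramSchmidt_ne_zero i (hli hp)))
    refine h.congr (.of_forall fun q ↦ ?_)
    simp only [← norm_eq_sqrt_real_inner]
    rfl
  · exact Filter.mem_of_superset (t.open_baseSet.mem_nhds hp) fun q hq ↦
      InnerProductSpace.gramSchmidtNormed_orthonormal (hli hq)

theorem exists_orthonormalBasis_eq {q : M}
    {v : Fin (Module.finrank ℝ E) → TangentSpace I q} (hv : Orthonormal ℝ v) :
    ∃ b : OrthonormalBasis (Fin (Module.finrank ℝ E)) ℝ (TangentSpace I q), ⇑b = v := by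
  obtain ⟨b, hb⟩ := Orthonormal.exists_orthonormalBasis_extension_of_card_eq
    (𝕜 := ℝ) (E := TangentSpace I q) (v := v) (s := Set.univ)
    (by rw [Fintype.card_fin]; rfl) (hv.comp _ Subtype.val_injective)
  exact ⟨b, funext fun i ↦ hb i trivial⟩

theorem inner_nabla_add (hX : MDiffAt (T% X) p) (hY : MDiffAt (T% Y) p) (hZ : MDiffAt (T% Z) p) :
    mvfderiv I (fun y ↦ (inner ℝ (Y y) (Z y) : ℝ)) p (X p) =
      inner ℝ (nabla X Y p) (Z p) + inner ℝ (Y p) (nabla X Z p) :=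
  isLeviCivita_leviCivita.metric hX hY hZ

theorem nabla_sub_nabla (hX : MDiffAt (T% X) p) (hY : MDiffAt (T% Y) p) :
    nabla X Y p - nabla Y X p = mlieBracket I X Y p := by
  have : CompleteSpace E := FiniteDimensional.complete ℝ E
  exact (CovariantDerivative.torsion_eq_zero_iff _).1
    (isLeviCivita_leviCivita (I := I) (M := M)).torsion_free hX hY

/-- The Koszul formula, derived from the two Levi-Civita axioms because the connection is known only
through them. -/
theorem two_mul_inner_nabla (hX : MDiffAt (T% X) p) (hY : MDiffAt (T% Y) p)
    (hZ : MDiffAt (T% Z) p) : 2 * inner ℝ (nabla X Y p) (Z p) = koszul X Y Z p := by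
  rw [koszul, inner_nabla_add hX hY hZ, inner_nabla_add hY hZ hX, inner_nabla_add hZ hX hY,
    ← nabla_sub_nabla hX hY, ← nabla_sub_nabla hY hZ, ← nabla_sub_nabla hZ hX]
  simp only [inner_sub_left, real_inner_comm]
  ring

theorem SmoothFieldNear.koszul (hX : SmoothFieldNear X p) (hY : SmoothFieldNear Y p)
    (hZ : SmoothFieldNear Z p) : SmoothNear I (RiemannianGeometry.koszul X Y Z) p := by
  have : CompleteSpace E := FiniteDimensional.complete ℝ E
  exact ((((((hY.inner hZ).mvfderiv_apply hX).add ((hZ.inner hX).mvfderiv_apply hY)).sub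
    ((hX.inner hY).mvfderiv_apply hZ)).add ((hX.mlieBracket hY).inner hZ)).sub
    ((hY.mlieBracket hZ).inner hX)).add ((hZ.mlieBracket hX).inner hY)

/-- In a smooth orthonormal frame the coefficients of ∇_X Y are half the Koszul expressions, which
are smooth. -/
theorem SmoothFieldNear.nabla (hX : SmoothFieldNear X p) (hY : SmoothFieldNear Y p) :
    SmoothFieldNear (nabla X Y) p := by
  obtain ⟨e, he, hon⟩ := exists_orthonormal_frame I p
  have h : SmoothFieldNear
      (fun q ↦ ∑ i, ((fun q ↦ 2⁻¹ * RiemannianGeometry.koszul X Y (e i) q) • e i) q) p :=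
    .sum fun i _ ↦ (he i).smul ((SmoothNear.const 2⁻¹).mul (hX.koszul hY (he i)))
  refine h.congr ?_
  filter_upwards [hon, hX.eventually, hY.eventually,
    Filter.eventually_all.2 fun i ↦ (he i).eventually] with q hq hXq hYq heq
  obtain ⟨b, hb⟩ := exists_orthonormalBasis_eq hq
  rw [← b.sum_repr' (RiemannianGeometry.nabla X Y q)]
  refine Finset.sum_congr rfl fun i _ ↦ ?_
  simp only [Pi.smul_apply', ← two_mul_inner_nabla hXq.mdifferentiableAt hYq.mdifferentiableAt
    (heq i).mdifferentiableAt, congr_fun hb i, real_inner_comm]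
  rw [inv_mul_cancel_left₀ two_ne_zero]

end Connection

/-! ### Forms with the symmetries of R and of ∇R -/

section Algebraic

variable {V : Type*} [AddCommGroup V] [Module ℝ V]

/-- A quadrilinear form with the algebraic symmetries of a curvature tensor. -/
structure IsCurvatureLike (R : V → V → V → V → ℝ) : Prop where
  add : ∀ x x' y z u, R (x + x') y z u = R x y z u + R x' y z u
  smul : ∀ (c : ℝ) x y z u, R (c • x) y z u = c * R x y z u
  swap_left : ∀ x y z u, R x y z u = -R y x z u
  swap_right : ∀ x y z u, R x y z u = -R x y u z
  pair : ∀ x y z u, R x y z u = R z u x y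
  bianchi : ∀ x y z u, R x y z u + R y z x u + R z x y u = 0

/-- A form with the algebraic symmetries of the covariant derivative of a curvature tensor. -/
structure IsNablaCurvatureLike (T : V → V → V → V → V → ℝ) : Prop where
  curvatureLike : ∀ w, IsCurvatureLike (T w)
  add : ∀ w w' x y z u, T (w + w') x y z u = T w x y z u + T w' x y z u
  smul : ∀ (c : ℝ) w x y z u, T (c • w) x y z u = c * T w x y z u
  bianchi : ∀ w x y z u, T w x y z u + T x y w z u + T y w x z u = 0

namespace IsCurvatureLike

variable {R : V → V → V → V → ℝ}

theorem add₂ (h : IsCurvatureLike R) (x y y' z u : V) :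
    R x (y + y') z u = R x y z u + R x y' z u := by
  rw [h.swap_left, h.add, h.swap_left y, h.swap_left y']; ring

theorem add₃ (h : IsCurvatureLike R) (x y z z' u : V) :
    R x y (z + z') u = R x y z u + R x y z' u := by
  rw [h.pair, h.add, h.pair z, h.pair z']

theorem add₄ (h : IsCurvatureLike R) (x y z u u' : V) :
    R x y z (u + u') = R x y z u + R x y z u' := by
  rw [h.swap_right, h.add₃, h.swap_right x y u, h.swap_right x y u']; ring

theorem smul₂ (h : IsCurvatureLike R) (c : ℝ) (x y z u : V) :
    R x (c • y) z u = c * R x y z u := by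
  rw [h.swap_left, h.smul, h.swap_left y]; ring

theorem smul₃ (h : IsCurvatureLike R) (c : ℝ) (x y z u : V) :
    R x y (c • z) u = c * R x y z u := by
  rw [h.pair, h.smul, h.pair z]

theorem smul₄ (h : IsCurvatureLike R) (c : ℝ) (x y z u : V) :
    R x y z (c • u) = c * R x y z u := by
  rw [h.swap_right, h.smul₃, h.swap_right x y u]; ring

theorem sub (h : IsCurvatureLike R) (x x' y z u : V) :
    R (x - x') y z u = R x y z u - R x' y z u := by
  rw [sub_eq_add_neg, ← neg_one_smul ℝ x', h.add, h.smul]; ring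

theorem self_left (h : IsCurvatureLike R) (x z u : V) : R x x z u = 0 := by
  linarith [h.swap_left x x z u]

end IsCurvatureLike

/-- The classical octahedron argument: add up the Bianchi identities for the four cyclic shifts. The
arguments range over a bare type so that it also applies to smooth vector fields. -/
theorem pair_symm_of_bianchi {α : Type*} {R : α → α → α → α → ℝ}
    (h1 : ∀ x y z u, R x y z u = -R y x z u)
    (h2 : ∀ x y z u, R x y z u = -R x y u z)
    (h3 : ∀ x y z u, R x y z u + R y z x u + R z x y u = 0) (x y z u : α) :
    R x y z u = R z u x y := by
  linarith [h3 x y z u, h3 y z u x, h3 z u x y, h3 u x y z, h1 x y z u, h1 z u x y, h2 x y z u,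
    h2 z u x y, h1 y z x u, h1 z x y u, h2 y z u x, h1 z u y x, h1 u y z x, h2 u y z x,
    h1 u x z y, h1 x z u y, h2 x z u y, h2 u x z y, h2 z u y x, h1 x y u z, h1 y u x z,
    h2 y u x z, h2 x y u z, h1 y z u x, h1 u x y z, h2 u x y z, h2 y z x u, h2 z x y u]

end Algebraic

/-! ### The curvature is a tensor with the curvature symmetries -/

section Curvature

variable {E : Type*} [NormedAddCommGroup E] [NormedSpace ℝ E] [FiniteDimensional ℝ E]
  {H : Type*} [TopologicalSpace H] {I : ModelWithCorners ℝ E H}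
  {M : Type*} [TopologicalSpace M] [ChartedSpace H M] [IsManifold I ∞ M]
  [RiemannianBundle (fun x : M ↦ TangentSpace I x)]
  [IsContMDiffRiemannianBundle I ∞ E (fun x : M ↦ TangentSpace I x)]
  {p : M} {W X X' Y Y' Z Z' U U' : Π x : M, TangentSpace I x} {f : M → ℝ}

theorem nabla_add_left : nabla (X + X') Y = nabla X Y + nabla X' Y := by
  funext q
  exact map_add (leviCivita I M Y q) _ _

theorem nabla_smul_left : nabla (f • X) Y = f • nabla X Y := by
  funext q
  exact map_smul (leviCivita I M Y q) _ _

theorem nabla_neg_left : nabla (-X) Y = -nabla X Y := by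
  funext q
  exact map_neg (leviCivita I M Y q) _

theorem nabla_add_right (hY : MDiffAt (T% Y) p) (hY' : MDiffAt (T% Y') p) :
    nabla X (Y + Y') p = nabla X Y p + nabla X Y' p :=
  congr($((leviCivita I M).isCovariantDerivativeOnUniv.add hY hY') (X p))

theorem nabla_smul_right (hf : MDiffAt f p) (hY : MDiffAt (T% Y) p) :
    nabla X (f • Y) p = f p • nabla X Y p + mvfderiv I f p (X p) • Y p :=
  congr($((leviCivita I M).isCovariantDerivativeOnUniv.leibniz hY hf) (X p))

theorem nabla_sub_right (hY' : MDiffAt (T% Y') p) (h : MDiffAt (T% (Y - Y')) p) :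
    nabla X (Y - Y') p = nabla X Y p - nabla X Y' p := by
  rw [eq_sub_iff_add_eq, ← nabla_add_right h hY', sub_add_cancel]

theorem nabla_congr_right (hY : MDiffAt (T% Y) p) (hY' : MDiffAt (T% Y') p)
    (h : ∀ᶠ q in 𝓝 p, Y q = Y' q) : nabla X Y p = nabla X Y' p :=
  congr($((leviCivita I M).isCovariantDerivativeOnUniv.congr_of_eventuallyEq hY hY'
    Filter.univ_mem h) (X p))

theorem SmoothFieldNear.curvatureOperator (hX : SmoothFieldNear X p) (hY : SmoothFieldNear Y p)
    (hZ : SmoothFieldNear Z p) : SmoothFieldNear (curvatureOperator X Y Z) p := by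
  have : CompleteSpace E := FiniteDimensional.complete ℝ E
  exact ((hX.nabla (hY.nabla hZ)).sub (hY.nabla (hX.nabla hZ))).sub ((hX.mlieBracket hY).nabla hZ)

theorem SmoothFieldNear.curvatureField (hX : SmoothFieldNear X p) (hY : SmoothFieldNear Y p)
    (hZ : SmoothFieldNear Z p) (hU : SmoothFieldNear U p) :
    SmoothNear I (curvatureField X Y Z U) p :=
  (hX.curvatureOperator hY hZ).inner hU

theorem curvatureOperator_smul_left (hf : SmoothNear I f p) (hX : SmoothFieldNear X p)
    (hZ : SmoothFieldNear Z p) :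
    curvatureOperator (f • X) Y Z p = f p • curvatureOperator X Y Z p := by
  have : CompleteSpace E := FiniteDimensional.complete ℝ E
  have h : nabla (mlieBracket I (f • X) Y) Z p =
      -(mvfderiv I f p (Y p)) • nabla X Z p + f p • nabla (mlieBracket I X Y) Z p := by
    simp only [nabla]
    rw [mlieBracket_smul_left hf.mdifferentiableAt hX.mdifferentiableAt, map_add, map_smul,
      map_smul]
  rw [curvatureOperator, curvatureOperator, h, nabla_smul_left, nabla_smul_left,
    nabla_smul_right hf.mdifferentiableAt (hX.nabla hZ).mdifferentiableAt, Pi.smul_apply']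
  module

theorem curvatureOperator_add_left (hX : SmoothFieldNear X p) (hX' : SmoothFieldNear X' p)
    (hZ : SmoothFieldNear Z p) :
    curvatureOperator (X + X') Y Z p = curvatureOperator X Y Z p + curvatureOperator X' Y Z p := by
  have : CompleteSpace E := FiniteDimensional.complete ℝ E
  have h : nabla (mlieBracket I (X + X') Y) Z p =
      nabla (mlieBracket I X Y) Z p + nabla (mlieBracket I X' Y) Z p := by
    simp only [nabla]
    rw [mlieBracket_add_left hX.mdifferentiableAt hX'.mdifferentiableAt, map_add]
  rw [curvatureOperator, curvatureOperator, curvatureOperator, h, nabla_add_left, nabla_add_left,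
    nabla_add_right (hX.nabla hZ).mdifferentiableAt (hX'.nabla hZ).mdifferentiableAt, Pi.add_apply]
  abel

theorem curvatureOperator_swap : curvatureOperator X Y Z p = -curvatureOperator Y X Z p := by
  rw [curvatureOperator, curvatureOperator, mlieBracket_swap (V := X), nabla_neg_left,
    Pi.neg_apply]
  abel

theorem curvatureField_swap_left : curvatureField X Y Z U = -curvatureField Y X Z U := by
  funext q
  simp only [curvatureField, Pi.neg_apply]
  rw [curvatureOperator_swap, inner_neg_left]

/-- Apply [X, Y] = XY - YX to the function ⟨Z, U⟩ and expand by metric compatibility. The mixed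
terms, with one derivative on each of Z and U, cancel. -/
theorem curvatureField_swap_right (hX : SmoothFieldNear X p) (hY : SmoothFieldNear Y p)
    (hZ : SmoothFieldNear Z p) (hU : SmoothFieldNear U p) :
    curvatureField X Y Z U p = -curvatureField X Y U Z p := by
  have : CompleteSpace E := FiniteDimensional.complete ℝ E
  have second {X Y : Π x : M, TangentSpace I x} (hX : SmoothFieldNear X p)
      (hY : SmoothFieldNear Y p) :
      mvfderiv I (fun q ↦ mvfderiv I (fun r ↦ (inner ℝ (Z r) (U r) : ℝ)) q (Y q)) p (X p) =
        inner ℝ (nabla X (nabla Y Z) p) (U p) + inner ℝ (nabla Y Z p) (nabla X U p)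
          + (inner ℝ (nabla X Z p) (nabla Y U p) + inner ℝ (Z p) (nabla X (nabla Y U) p)) := by
    have h : (fun q ↦ mvfderiv I (fun r ↦ (inner ℝ (Z r) (U r) : ℝ)) q (Y q)) =ᶠ[𝓝 p]
        fun q ↦ inner ℝ (nabla Y Z q) (U q) + inner ℝ (Z q) (nabla Y U q) := by
      filter_upwards [hY.eventually, hZ.eventually, hU.eventually] with q h1 h2 h3
      exact inner_nabla_add h1.mdifferentiableAt h2.mdifferentiableAt h3.mdifferentiableAt
    rw [mvfderiv_congr h, mvfderiv_fun_add ((hY.nabla hZ).inner hU).mdifferentiableAt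
      (hZ.inner (hY.nabla hU)).mdifferentiableAt, add_apply,
      inner_nabla_add hX.mdifferentiableAt (hY.nabla hZ).mdifferentiableAt hU.mdifferentiableAt,
      inner_nabla_add hX.mdifferentiableAt hZ.mdifferentiableAt (hY.nabla hU).mdifferentiableAt]
  have h := mvfderiv_mlieBracket_apply (hZ.inner hU) hX hY
  rw [second hX hY, second hY hX, inner_nabla_add (hX.mlieBracket hY).mdifferentiableAt
    hZ.mdifferentiableAt hU.mdifferentiableAt] at h
  simp only [curvatureField, curvatureOperator, inner_sub_left]
  rw [real_inner_comm (Z p) (nabla X (nabla Y U) p), real_inner_comm (Z p) (nabla Y (nabla X U) p),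
    real_inner_comm (Z p) (nabla (mlieBracket I X Y) U p)]
  linarith

/-- Grouping the terms of the cyclic sum by the outer derivative and using torsion-freeness twice
turns each group into a double bracket; the three double brackets sum to zero by Jacobi. -/
theorem curvatureOperator_bianchi (hX : SmoothFieldNear X p) (hY : SmoothFieldNear Y p)
    (hZ : SmoothFieldNear Z p) :
    curvatureOperator X Y Z p + curvatureOperator Y Z X p + curvatureOperator Z X Y p = 0 := by
  have : CompleteSpace E := FiniteDimensional.complete ℝ E
  have key {X Y Z : Π x : M, TangentSpace I x} (hX : SmoothFieldNear X p)
      (hY : SmoothFieldNear Y p) (hZ : SmoothFieldNear Z p) :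
      nabla X (nabla Y Z) p - nabla X (nabla Z Y) p - nabla (mlieBracket I Y Z) X p =
        mlieBracket I X (mlieBracket I Y Z) p := by
    have hYZ := hY.mlieBracket hZ
    rw [← nabla_sub_nabla hX.mdifferentiableAt hYZ.mdifferentiableAt,
      ← nabla_sub_right (hZ.nabla hY).mdifferentiableAt
        ((hY.nabla hZ).sub (hZ.nabla hY)).mdifferentiableAt]
    congr 1
    refine nabla_congr_right ((hY.nabla hZ).sub (hZ.nabla hY)).mdifferentiableAt
      hYZ.mdifferentiableAt ?_
    filter_upwards [hY.eventually, hZ.eventually] with q h1 h2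
    exact nabla_sub_nabla h1.mdifferentiableAt h2.mdifferentiableAt
  have hj := mlieBracket_jacobi hX hY hZ
  rw [mlieBracket_swap_apply (V := mlieBracket I X Y), mlieBracket_swap (V := X) (W := Z)] at hj
  have hneg : mlieBracket I Y (-mlieBracket I Z X) p = -mlieBracket I Y (mlieBracket I Z X) p := by
    have := mlieBracket_const_smul_right (V := Y) (c := (-1 : ℝ))
      (hZ.mlieBracket hX).mdifferentiableAt
    simpa using! this
  rw [hneg, ← key hX hY hZ, ← key hY hZ hX, ← key hZ hX hY] at hj
  simp only [curvatureOperator]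
  rw [← sub_eq_zero] at hj
  rw [← hj]
  abel

theorem curvatureField_bianchi (hX : SmoothFieldNear X p) (hY : SmoothFieldNear Y p)
    (hZ : SmoothFieldNear Z p) :
    curvatureField X Y Z U p + curvatureField Y Z X U p + curvatureField Z X Y U p = 0 := by
  simp only [curvatureField, ← inner_add_left, curvatureOperator_bianchi hX hY hZ, inner_zero_left]

theorem curvatureField_pair (hX : SmoothFieldNear X p) (hY : SmoothFieldNear Y p)
    (hZ : SmoothFieldNear Z p) (hU : SmoothFieldNear U p) :
    curvatureField X Y Z U p = curvatureField Z U X Y p := by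
  let S := {X : Π x : M, TangentSpace I x // SmoothFieldNear X p}
  let R : S → S → S → S → ℝ := fun X Y Z U ↦ curvatureField X.1 Y.1 Z.1 U.1 p
  exact pair_symm_of_bianchi (R := R) (fun _ _ _ _ ↦ congr_fun curvatureField_swap_left p)
    (fun X Y Z U ↦ curvatureField_swap_right X.2 Y.2 Z.2 U.2)
    (fun X Y Z U ↦ curvatureField_bianchi X.2 Y.2 Z.2) ⟨X, hX⟩ ⟨Y, hY⟩ ⟨Z, hZ⟩ ⟨U, hU⟩

theorem curvatureField_tensorial (hZ : SmoothFieldNear Z p) :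
    SmoothTensorialAt (fun X ↦ curvatureField X Y Z U p) p where
  smul hf hX := by
    simp only [curvatureField]
    rw [curvatureOperator_smul_left hf hX hZ, inner_smul_left]
    simp
  add hX hX' := by
    simp only [curvatureField]
    rw [curvatureOperator_add_left hX hX' hZ, inner_add_left]

/-- Tensoriality in the first slot suffices: skewness carries it to the second, and pair symmetry to
the last two. -/
theorem curvatureField_congr (hX : SmoothFieldNear X p) (hX' : SmoothFieldNear X' p)
    (hY : SmoothFieldNear Y p) (hY' : SmoothFieldNear Y' p)
    (hZ : SmoothFieldNear Z p) (hZ' : SmoothFieldNear Z' p)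
    (hU : SmoothFieldNear U p) (hU' : SmoothFieldNear U' p)
    (hXX' : X p = X' p) (hYY' : Y p = Y' p) (hZZ' : Z p = Z' p) (hUU' : U p = U' p) :
    curvatureField X Y Z U p = curvatureField X' Y' Z' U' p := by
  have left {X X' Y Y' Z U : Π x : M, TangentSpace I x} (hX : SmoothFieldNear X p)
      (hX' : SmoothFieldNear X' p) (hY : SmoothFieldNear Y p) (hY' : SmoothFieldNear Y' p)
      (hZ : SmoothFieldNear Z p) (hXX' : X p = X' p) (hYY' : Y p = Y' p) :
      curvatureField X Y Z U p = curvatureField X' Y' Z U p := by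
    rw [(curvatureField_tensorial hZ).pointwise hX hX' hXX', curvatureField_swap_left,
      Pi.neg_apply, (curvatureField_tensorial hZ).pointwise hY hY' hYY', ← Pi.neg_apply,
      ← curvatureField_swap_left]
  rw [left hX hX' hY hY' hZ hXX' hYY', curvatureField_pair hX' hY' hZ hU,
    left hZ hZ' hU hU' hX' hZZ' hUU', curvatureField_pair hZ' hU' hX' hY']

theorem curvatureField_eq_curvatureTensor (hX : SmoothFieldNear X p) (hY : SmoothFieldNear Y p)
    (hZ : SmoothFieldNear Z p) (hU : SmoothFieldNear U p) :
    curvatureField X Y Z U p = curvatureTensor p (X p) (Y p) (Z p) (U p) :=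
  curvatureField_congr hX (.extend _) hY (.extend _) hZ (.extend _) hU (.extend _)
    (by simp) (by simp) (by simp) (by simp)

theorem isCurvatureLike_curvatureTensor (p : M) :
    IsCurvatureLike (curvatureTensor (I := I) p) where
  add x x' y z u := by
    simp only [curvatureTensor]
    rw [← (curvatureField_tensorial (.extend z)).add (.extend x) (.extend x')]
    exact (curvatureField_tensorial (.extend z)).pointwise (.extend _)
      ((SmoothFieldNear.extend x).add (.extend x')) (by simp)
  smul c x y z u := by
    simp only [curvatureTensor]
    rw [← (curvatureField_tensorial (.extend z)).smul (SmoothNear.const c) (.extend x)]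
    exact (curvatureField_tensorial (.extend z)).pointwise (.extend _)
      ((SmoothFieldNear.extend x).smul (.const c)) (by simp)
  swap_left _ _ _ _ := congr_fun curvatureField_swap_left p
  swap_right _ _ _ _ := curvatureField_swap_right (.extend _) (.extend _) (.extend _) (.extend _)
  pair _ _ _ _ := curvatureField_pair (.extend _) (.extend _) (.extend _) (.extend _)
  bianchi _ _ _ _ := curvatureField_bianchi (.extend _) (.extend _) (.extend _)

end Curvature

/-! ### The covariant derivative of R is a tensor satisfying the second Bianchi identity -/

section NablaCurvature

variable {E : Type*} [NormedAddCommGroup E] [NormedSpace ℝ E] [FiniteDimensional ℝ E]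
  {H : Type*} [TopologicalSpace H] {I : ModelWithCorners ℝ E H}
  {M : Type*} [TopologicalSpace M] [ChartedSpace H M] [IsManifold I ∞ M]
  [RiemannianBundle (fun x : M ↦ TangentSpace I x)]
  [IsContMDiffRiemannianBundle I ∞ E (fun x : M ↦ TangentSpace I x)]
  {p : M} {W W' X X' Y Y' Z Z' U U' : Π x : M, TangentSpace I x} {f : M → ℝ}

/-- With the four correction terms written through the pointwise tensor, its multilinearity and
symmetries apply to them directly. -/
theorem nablaCurvatureField_eq (hW : SmoothFieldNear W p) (hX : SmoothFieldNear X p)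
    (hY : SmoothFieldNear Y p) (hZ : SmoothFieldNear Z p) (hU : SmoothFieldNear U p) :
    nablaCurvatureField W X Y Z U p = mvfderiv I (curvatureField X Y Z U) p (W p)
      - curvatureTensor p (nabla W X p) (Y p) (Z p) (U p)
      - curvatureTensor p (X p) (nabla W Y p) (Z p) (U p)
      - curvatureTensor p (X p) (Y p) (nabla W Z p) (U p)
      - curvatureTensor p (X p) (Y p) (Z p) (nabla W U p) := by
  rw [nablaCurvatureField, curvatureField_eq_curvatureTensor (hW.nabla hX) hY hZ hU,
    curvatureField_eq_curvatureTensor hX (hW.nabla hY) hZ hU,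
    curvatureField_eq_curvatureTensor hX hY (hW.nabla hZ) hU,
    curvatureField_eq_curvatureTensor hX hY hZ (hW.nabla hU)]

theorem nablaCurvatureField_tensorial₁ (hX : SmoothFieldNear X p)
    (hY : SmoothFieldNear Y p) (hZ : SmoothFieldNear Z p) (hU : SmoothFieldNear U p) :
    SmoothTensorialAt (fun W ↦ nablaCurvatureField W X Y Z U p) p where
  smul hf hW := by
    have h := isCurvatureLike_curvatureTensor (I := I) p
    rw [nablaCurvatureField_eq (hW.smul hf) hX hY hZ hU, nablaCurvatureField_eq hW hX hY hZ hU]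
    simp only [nabla_smul_left, Pi.smul_apply', h.smul, h.smul₂, h.smul₃, h.smul₄, map_smul,
      smul_eq_mul]
    ring
  add hW hW' := by
    have h := isCurvatureLike_curvatureTensor (I := I) p
    rw [nablaCurvatureField_eq (hW.add hW') hX hY hZ hU, nablaCurvatureField_eq hW hX hY hZ hU,
      nablaCurvatureField_eq hW' hX hY hZ hU]
    simp only [nabla_add_left, Pi.add_apply, h.add, h.add₂, h.add₃, h.add₄, map_add]
    ring

/-- The term with the derivative of f in W(f R(X, Y, Z, U)) cancels against the one from ∇_W(fX). -/
theorem nablaCurvatureField_tensorial₂ (hW : SmoothFieldNear W p)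
    (hY : SmoothFieldNear Y p) (hZ : SmoothFieldNear Z p) (hU : SmoothFieldNear U p) :
    SmoothTensorialAt (fun X ↦ nablaCurvatureField W X Y Z U p) p where
  smul {f X} hf hX := by
    have h := isCurvatureLike_curvatureTensor (I := I) p
    have hR : curvatureField (f • X) Y Z U =ᶠ[𝓝 p] fun q ↦ f q * curvatureField X Y Z U q := by
      filter_upwards [hf.eventually, hX.eventually, hZ.eventually] with q hf hX hZ
      exact (curvatureField_tensorial hZ).smul hf hX
    rw [nablaCurvatureField_eq hW (hX.smul hf) hY hZ hU, nablaCurvatureField_eq hW hX hY hZ hU,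
      mvfderiv_congr hR, mvfderiv_fun_mul hf.mdifferentiableAt
        (hX.curvatureField hY hZ hU).mdifferentiableAt,
      nabla_smul_right hf.mdifferentiableAt hX.mdifferentiableAt]
    simp only [Pi.smul_apply', h.smul, h.add, add_apply, smul_apply, smul_eq_mul,
      curvatureField_eq_curvatureTensor hX hY hZ hU]
    ring
  add {X X'} hX hX' := by
    have h := isCurvatureLike_curvatureTensor (I := I) p
    have hR : curvatureField (X + X') Y Z U =ᶠ[𝓝 p]
        fun q ↦ curvatureField X Y Z U q + curvatureField X' Y Z U q := by
      filter_upwards [hX.eventually, hX'.eventually, hZ.eventually] with q hX hX' hZ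
      exact (curvatureField_tensorial hZ).add hX hX'
    rw [nablaCurvatureField_eq hW (hX.add hX') hY hZ hU, nablaCurvatureField_eq hW hX hY hZ hU,
      nablaCurvatureField_eq hW hX' hY hZ hU, mvfderiv_congr hR,
      mvfderiv_fun_add (hX.curvatureField hY hZ hU).mdifferentiableAt
        (hX'.curvatureField hY hZ hU).mdifferentiableAt,
      nabla_add_right hX.mdifferentiableAt hX'.mdifferentiableAt]
    simp only [Pi.add_apply, h.add, add_apply]
    ring

theorem nablaCurvatureField_swap_left (hW : SmoothFieldNear W p) (hX : SmoothFieldNear X p)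
    (hY : SmoothFieldNear Y p) (hZ : SmoothFieldNear Z p) (hU : SmoothFieldNear U p) :
    nablaCurvatureField W X Y Z U p = -nablaCurvatureField W Y X Z U p := by
  have h := isCurvatureLike_curvatureTensor (I := I) p
  rw [nablaCurvatureField_eq hW hX hY hZ hU, nablaCurvatureField_eq hW hY hX hZ hU,
    curvatureField_swap_left, mvfderiv_neg, neg_apply, h.swap_left (nabla W X p),
    h.swap_left (X p) (nabla W Y p), h.swap_left (X p) (Y p), h.swap_left (X p) (Y p)]
  ring

theorem nablaCurvatureField_swap_right (hW : SmoothFieldNear W p) (hX : SmoothFieldNear X p)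
    (hY : SmoothFieldNear Y p) (hZ : SmoothFieldNear Z p) (hU : SmoothFieldNear U p) :
    nablaCurvatureField W X Y Z U p = -nablaCurvatureField W X Y U Z p := by
  have h := isCurvatureLike_curvatureTensor (I := I) p
  have hR : curvatureField X Y Z U =ᶠ[𝓝 p] -curvatureField X Y U Z := by
    filter_upwards [hX.eventually, hY.eventually, hZ.eventually, hU.eventually] with q hX hY hZ hU
    exact curvatureField_swap_right hX hY hZ hU
  rw [nablaCurvatureField_eq hW hX hY hZ hU, nablaCurvatureField_eq hW hX hY hU hZ,
    mvfderiv_congr hR, mvfderiv_neg, neg_apply, h.swap_right (nabla W X p),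
    h.swap_right (X p) (nabla W Y p), h.swap_right (X p) (Y p) (nabla W Z p),
    h.swap_right (X p) (Y p) (Z p) (nabla W U p)]
  ring

theorem nablaCurvatureField_pair (hW : SmoothFieldNear W p) (hX : SmoothFieldNear X p)
    (hY : SmoothFieldNear Y p) (hZ : SmoothFieldNear Z p) (hU : SmoothFieldNear U p) :
    nablaCurvatureField W X Y Z U p = nablaCurvatureField W Z U X Y p := by
  have h := isCurvatureLike_curvatureTensor (I := I) p
  have hR : curvatureField X Y Z U =ᶠ[𝓝 p] curvatureField Z U X Y := by
    filter_upwards [hX.eventually, hY.eventually, hZ.eventually, hU.eventually] with q hX hY hZ hU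
    exact curvatureField_pair hX hY hZ hU
  rw [nablaCurvatureField_eq hW hX hY hZ hU, nablaCurvatureField_eq hW hZ hU hX hY,
    mvfderiv_congr hR, h.pair (nabla W X p), h.pair (X p) (nabla W Y p), h.pair (X p) (Y p),
    h.pair (X p) (Y p)]
  ring

theorem nablaCurvatureField_bianchi_first (hW : SmoothFieldNear W p) (hX : SmoothFieldNear X p)
    (hY : SmoothFieldNear Y p) (hZ : SmoothFieldNear Z p) (hU : SmoothFieldNear U p) :
    nablaCurvatureField W X Y Z U p + nablaCurvatureField W Y Z X U p
      + nablaCurvatureField W Z X Y U p = 0 := by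
  have h := isCurvatureLike_curvatureTensor (I := I) p
  have hR : curvatureField X Y Z U =ᶠ[𝓝 p]
      -(fun q ↦ curvatureField Y Z X U q + curvatureField Z X Y U q) := by
    filter_upwards [hX.eventually, hY.eventually, hZ.eventually] with q hX hY hZ
    simp only [Pi.neg_apply]
    linarith [curvatureField_bianchi (U := U) hX hY hZ]
  rw [nablaCurvatureField_eq hW hX hY hZ hU, nablaCurvatureField_eq hW hY hZ hX hU,
    nablaCurvatureField_eq hW hZ hX hY hU, mvfderiv_congr hR, mvfderiv_neg, neg_apply,
    mvfderiv_fun_add (hY.curvatureField hZ hX hU).mdifferentiableAt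
      (hZ.curvatureField hX hY hU).mdifferentiableAt, add_apply]
  linarith [h.bianchi (nabla W X p) (Y p) (Z p) (U p), h.bianchi (X p) (nabla W Y p) (Z p) (U p),
    h.bianchi (X p) (Y p) (nabla W Z p) (U p), h.bianchi (X p) (Y p) (Z p) (nabla W U p)]

/-- Each summand is ([∇_W, R(X, Y)] - R([W, X], Y)) Z. In the cyclic sum the triple commutators of
∇_W, ∇_X, ∇_Y cancel by the Jacobi identity for operators, the terms [∇_W, ∇_[X,Y]] cancel in pairs,
and what is left is ∇ along a sum of double brackets, zero by Jacobi for fields. -/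
theorem cyclic_sum_nabla_curvatureOperator (hW : SmoothFieldNear W p) (hX : SmoothFieldNear X p)
    (hY : SmoothFieldNear Y p) (hZ : SmoothFieldNear Z p) :
    (nabla W (curvatureOperator X Y Z) p - curvatureOperator X Y (nabla W Z) p
        - curvatureOperator (mlieBracket I W X) Y Z p)
      + (nabla X (curvatureOperator Y W Z) p - curvatureOperator Y W (nabla X Z) p
        - curvatureOperator (mlieBracket I X Y) W Z p)
      + (nabla Y (curvatureOperator W X Z) p - curvatureOperator W X (nabla Y Z) p
        - curvatureOperator (mlieBracket I Y W) X Z p) = 0 := by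
  have : CompleteSpace E := FiniteDimensional.complete ℝ E
  have expand {W X Y : Π x : M, TangentSpace I x} (hX : SmoothFieldNear X p)
      (hY : SmoothFieldNear Y p) :
      nabla W (curvatureOperator X Y Z) p = nabla W (nabla X (nabla Y Z)) p
        - nabla W (nabla Y (nabla X Z)) p - nabla W (nabla (mlieBracket I X Y) Z) p := by
    have h1 := hX.nabla (hY.nabla hZ)
    have h2 := hY.nabla (hX.nabla hZ)
    have h3 := (hX.mlieBracket hY).nabla hZ
    rw [← nabla_sub_right h2.mdifferentiableAt (h1.sub h2).mdifferentiableAt,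
      ← nabla_sub_right h3.mdifferentiableAt ((h1.sub h2).sub h3).mdifferentiableAt]
    rfl
  have hj := mlieBracket_jacobi hW hX hY
  rw [mlieBracket_swap_apply (V := W) (W := mlieBracket I X Y),
    mlieBracket_swap_apply (V := X) (W := mlieBracket I W Y), mlieBracket_swap (V := W) (W := Y)]
    at hj
  have hneg : mlieBracket I (-mlieBracket I Y W) X p = -mlieBracket I (mlieBracket I Y W) X p := by
    simpa using! mlieBracket_const_smul_left (W := X) (c := (-1 : ℝ))
      (hY.mlieBracket hW).mdifferentiableAt
  rw [hneg, neg_neg] at hj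
  have hj' : nabla (mlieBracket I (mlieBracket I W X) Y) Z p
      + nabla (mlieBracket I (mlieBracket I X Y) W) Z p
      + nabla (mlieBracket I (mlieBracket I Y W) X) Z p = 0 := by
    simp only [nabla]
    rw [← map_add, ← map_add]
    convert map_zero (leviCivita I M Z p) using 2
    rw [add_right_comm, ← hj]
    abel
  rw [expand hX hY, expand hY hW, expand hW hX, ← hj']
  simp only [curvatureOperator]
  abel

/-- The previous cyclic sum, paired with U, accounts for everything except terms of the form R([W,
X], Y) and the corrections in the first two slots of R. Writing [W, X] = ∇_W X - ∇_X W makes these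
cancel. -/
theorem nablaCurvatureField_bianchi (hW : SmoothFieldNear W p) (hX : SmoothFieldNear X p)
    (hY : SmoothFieldNear Y p) (hZ : SmoothFieldNear Z p) (hU : SmoothFieldNear U p) :
    nablaCurvatureField W X Y Z U p + nablaCurvatureField X Y W Z U p
      + nablaCurvatureField Y W X Z U p = 0 := by
  have : CompleteSpace E := FiniteDimensional.complete ℝ E
  have h := isCurvatureLike_curvatureTensor (I := I) p
  have expand {W X Y : Π x : M, TangentSpace I x} (hW : SmoothFieldNear W p)
      (hX : SmoothFieldNear X p) (hY : SmoothFieldNear Y p) :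
      nablaCurvatureField W X Y Z U p =
        inner ℝ (nabla W (curvatureOperator X Y Z) p - curvatureOperator X Y (nabla W Z) p
          - curvatureOperator (mlieBracket I W X) Y Z p) (U p)
        + curvatureTensor p (mlieBracket I W X p) (Y p) (Z p) (U p)
        - curvatureTensor p (nabla W X p) (Y p) (Z p) (U p)
        - curvatureTensor p (X p) (nabla W Y p) (Z p) (U p) := by
    have h1 : mvfderiv I (curvatureField X Y Z U) p (W p) =
        inner ℝ (nabla W (curvatureOperator X Y Z) p) (U p)
          + inner ℝ (curvatureOperator X Y Z p) (nabla W U p) :=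
      inner_nabla_add hW.mdifferentiableAt (hX.curvatureOperator hY hZ).mdifferentiableAt
        hU.mdifferentiableAt
    rw [nablaCurvatureField_eq hW hX hY hZ hU,
      ← curvatureField_eq_curvatureTensor hX hY (hW.nabla hZ) hU,
      ← curvatureField_eq_curvatureTensor hX hY hZ (hW.nabla hU),
      ← curvatureField_eq_curvatureTensor (hW.mlieBracket hX) hY hZ hU, inner_sub_left,
      inner_sub_left, h1]
    simp only [curvatureField]
    ring
  have hc := congr(inner ℝ $(cyclic_sum_nabla_curvatureOperator hW hX hY hZ) (U p))
  rw [inner_add_left, inner_add_left, inner_zero_left] at hc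
  rw [expand hW hX hY, expand hX hY hW, expand hY hW hX,
    ← nabla_sub_nabla hW.mdifferentiableAt hX.mdifferentiableAt,
    ← nabla_sub_nabla hX.mdifferentiableAt hY.mdifferentiableAt,
    ← nabla_sub_nabla hY.mdifferentiableAt hW.mdifferentiableAt, h.sub, h.sub, h.sub,
    h.swap_left (X p), h.swap_left (Y p) (nabla X W p), h.swap_left (W p) (nabla Y X p)]
  linear_combination hc

theorem nablaCurvatureField_congr (hW : SmoothFieldNear W p) (hW' : SmoothFieldNear W' p)
    (hX : SmoothFieldNear X p) (hX' : SmoothFieldNear X' p)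
    (hY : SmoothFieldNear Y p) (hY' : SmoothFieldNear Y' p)
    (hZ : SmoothFieldNear Z p) (hZ' : SmoothFieldNear Z' p)
    (hU : SmoothFieldNear U p) (hU' : SmoothFieldNear U' p) (hWW' : W p = W' p)
    (hXX' : X p = X' p) (hYY' : Y p = Y' p) (hZZ' : Z p = Z' p) (hUU' : U p = U' p) :
    nablaCurvatureField W X Y Z U p = nablaCurvatureField W' X' Y' Z' U' p := by
  have left {X X' Y Y' Z U : Π x : M, TangentSpace I x} (hX : SmoothFieldNear X p)
      (hX' : SmoothFieldNear X' p) (hY : SmoothFieldNear Y p) (hY' : SmoothFieldNear Y' p)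
      (hZ : SmoothFieldNear Z p) (hU : SmoothFieldNear U p) (hXX' : X p = X' p)
      (hYY' : Y p = Y' p) :
      nablaCurvatureField W' X Y Z U p = nablaCurvatureField W' X' Y' Z U p := by
    rw [(nablaCurvatureField_tensorial₂ hW' hY hZ hU).pointwise hX hX' hXX',
      nablaCurvatureField_swap_left hW' hX' hY hZ hU,
      (nablaCurvatureField_tensorial₂ hW' hX' hZ hU).pointwise hY hY' hYY',
      ← nablaCurvatureField_swap_left hW' hX' hY' hZ hU]
  rw [(nablaCurvatureField_tensorial₁ hX hY hZ hU).pointwise hW hW' hWW',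
    left hX hX' hY hY' hZ hU hXX' hYY', nablaCurvatureField_pair hW' hX' hY' hZ hU,
    left hZ hZ' hU hU' hX' hY' hZZ' hUU', nablaCurvatureField_pair hW' hZ' hU' hX' hY']

theorem nablaCurvatureField_eq_nablaCurvature (hW : SmoothFieldNear W p)
    (hX : SmoothFieldNear X p) (hY : SmoothFieldNear Y p) (hZ : SmoothFieldNear Z p)
    (hU : SmoothFieldNear U p) :
    nablaCurvatureField W X Y Z U p = nablaCurvature p (W p) (X p) (Y p) (Z p) (U p) :=
  nablaCurvatureField_congr hW (.extend _) hX (.extend _) hY (.extend _) hZ (.extend _)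
    hU (.extend _) (by simp) (by simp) (by simp) (by simp) (by simp)

theorem isNablaCurvatureLike_nablaCurvature (p : M) :
    IsNablaCurvatureLike (nablaCurvature (I := I) p) where
  curvatureLike w :=
    { add := fun x x' y z u ↦ by
        have h := nablaCurvatureField_tensorial₂ (.extend w) (.extend y) (.extend z) (.extend u)
        simp only [nablaCurvature]
        rw [← h.add (.extend x) (.extend x')]
        exact h.pointwise (.extend _) ((SmoothFieldNear.extend x).add (.extend x')) (by simp)
      smul := fun c x y z u ↦ by
        have h := nablaCurvatureField_tensorial₂ (.extend w) (.extend y) (.extend z) (.extend u)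
        simp only [nablaCurvature]
        rw [← h.smul (SmoothNear.const c) (.extend x)]
        exact h.pointwise (.extend _) ((SmoothFieldNear.extend x).smul (.const c)) (by simp)
      swap_left := fun _ _ _ _ ↦ nablaCurvatureField_swap_left (.extend _) (.extend _) (.extend _)
        (.extend _) (.extend _)
      swap_right := fun _ _ _ _ ↦ nablaCurvatureField_swap_right (.extend _) (.extend _)
        (.extend _) (.extend _) (.extend _)
      pair := fun _ _ _ _ ↦ nablaCurvatureField_pair (.extend _) (.extend _) (.extend _)
        (.extend _) (.extend _)
      bianchi := fun _ _ _ _ ↦ nablaCurvatureField_bianchi_first (.extend _) (.extend _)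
        (.extend _) (.extend _) (.extend _) }
  add w w' x y z u := by
    have h := nablaCurvatureField_tensorial₁ (.extend x) (.extend y) (.extend z) (.extend u)
    simp only [nablaCurvature]
    rw [← h.add (.extend w) (.extend w')]
    exact h.pointwise (.extend _) ((SmoothFieldNear.extend w).add (.extend w')) (by simp)
  smul c w x y z u := by
    have h := nablaCurvatureField_tensorial₁ (.extend x) (.extend y) (.extend z) (.extend u)
    simp only [nablaCurvature]
    rw [← h.smul (SmoothNear.const c) (.extend w)]
    exact h.pointwise (.extend _) ((SmoothFieldNear.extend w).smul (.const c)) (by simp)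
  bianchi _ _ _ _ _ := nablaCurvatureField_bianchi (.extend _) (.extend _) (.extend _)
    (.extend _) (.extend _)

end NablaCurvature

/-! ### Forms of this kind are determined by their values T(x; x, y, y, x) -/

section Algebraic

variable {V : Type*} [AddCommGroup V] [Module ℝ V]

theorem IsCurvatureLike.reverse {R : V → V → V → V → ℝ} (h : IsCurvatureLike R) (x y z u : V) :
    R x y z u = R u z y x := by
  rw [h.pair, h.swap_left, h.swap_right, neg_neg]

/-- Polarising the hypothesis makes R skew in its outer arguments, hence alternating in all four.
Cyclic permutations of three arguments are even, so the Bianchi identity reads 3R = 0. -/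
theorem IsCurvatureLike.eq_zero {R : V → V → V → V → ℝ} (h : IsCurvatureLike R)
    (h0 : ∀ x y z, R x y z x = 0) (x y z u : V) : R x y z u = 0 := by
  have flip (x y z u : V) : R x y z u = -R u y z x := by
    have h1 := h0 (x + u) y z
    rw [h.add, h.add₄, h.add₄, h0, h0] at h1
    linarith
  have cyc (x y z u : V) : R x y z u = R y z x u := by
    rw [h.pair x y z u, flip z u x y, h.pair y u x z, h.swap_left x z, h.pair z x y u,
      h.pair y u z x, h.swap_left z x y u, flip x z y u, h.pair y z x u, h.pair u z y x,
      h.swap_left x u y z, flip u x y z, h.swap_left z x y u]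
    linarith [flip u z y x, flip y x u z, h.pair y x u z, h.swap_right u z y x, flip x u y z,
      h.swap_left x u y z]
  linarith [h.bianchi x y z u, cyc x y z u, cyc y z x u]

/-- Polarisation and the second Bianchi identity give, for fixed x, three linear relations between
the numbers T(w; x, y, z, x), T(y; x, z, w, x) and T(z; x, w, y, x): three times each is the sum of
the other two. So all three vanish, and `IsCurvatureLike.eq_zero` applies to each T(w; ·). -/
theorem IsNablaCurvatureLike.eq_zero {T : V → V → V → V → V → ℝ} (h : IsNablaCurvatureLike T)
    (h0 : ∀ x y, T x x y y x = 0) (w x y z u : V) : T w x y z u = 0 := by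
  have hc := h.curvatureLike
  have symm (w x y z : V) : T w x y z x = T w x z y x := (hc w).reverse _ _ _ _
  have hyz (x y z : V) : T x x y z x = 0 := by
    have h1 := h0 x (y + z)
    rw [(hc x).add₂, (hc x).add₃, (hc x).add₃, h0, h0, symm x x z y] at h1
    linarith
  -- T(x; x, y, z, x) is cubic in x; comparing its values at x + w and x - w isolates the part
  -- linear in w.
  have hlin (w x y z : V) : T w x y z x + T x w y z x + T x x y z w = 0 := by
    have h1 := hyz (x + w) y z
    have h2 := hyz (x + (-1 : ℝ) • w) y z
    simp only [h.add, h.smul, fun w ↦ (hc w).add, fun w ↦ (hc w).add₄, fun w ↦ (hc w).smul,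
      fun w ↦ (hc w).smul₄, hyz] at h1 h2
    linarith
  have hrel (w x y z : V) : 3 * T w x y z x = T y x w z x + T z x w y x := by
    have b1 := h.bianchi w x y z x
    have b2 := h.bianchi w x z y x
    have e1 := hlin w x y z
    have e2 : T x x y z w = T x w z y x := (hc x).reverse _ _ _ _
    rw [(hc y).swap_left w x] at b1
    rw [(hc z).swap_left w x] at b2
    rw [(hc x).swap_left y w] at b1
    rw [(hc x).swap_left z w] at b2
    linarith [symm w x y z]
  refine (hc w).eq_zero (fun x y z ↦ ?_) x y z u
  linarith [hrel w x y z, hrel y x z w, hrel z x w y, symm w x y z, symm y x z w, symm z x w y]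

theorem IsNablaCurvatureLike.sub_mul {S T : V → V → V → V → V → ℝ} (hS : IsNablaCurvatureLike S)
    (hT : IsNablaCurvatureLike T) (c : ℝ) :
    IsNablaCurvatureLike (fun w x y z u ↦ S w x y z u - c * T w x y z u) where
  curvatureLike w :=
    { add := fun x x' y z u ↦ by
        rw [(hS.curvatureLike w).add, (hT.curvatureLike w).add]; ring
      smul := fun a x y z u ↦ by
        rw [(hS.curvatureLike w).smul, (hT.curvatureLike w).smul]; ring
      swap_left := fun x y z u ↦ by
        rw [(hS.curvatureLike w).swap_left, (hT.curvatureLike w).swap_left]; ring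
      swap_right := fun x y z u ↦ by
        rw [(hS.curvatureLike w).swap_right, (hT.curvatureLike w).swap_right]; ring
      pair := fun x y z u ↦ by rw [(hS.curvatureLike w).pair, (hT.curvatureLike w).pair]
      bianchi := fun x y z u ↦ by
        linear_combination (hS.curvatureLike w).bianchi x y z u
          - c * (hT.curvatureLike w).bianchi x y z u }
  add w w' x y z u := by rw [hS.add, hT.add]; ring
  smul a w x y z u := by rw [hS.smul, hT.smul]; ring
  bianchi w x y z u := by
    linear_combination hS.bianchi w x y z u - c * hT.bianchi w x y z u

/-- Each skew pair contributes one factor of the determinant. It transfers vanishing from a single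
orthonormal basis of a plane to arbitrary vectors of that plane. -/
theorem IsCurvatureLike.apply_pair {R : V → V → V → V → ℝ} (h : IsCurvatureLike R)
    (a b c d : ℝ) (x y : V) :
    R (a • x + b • y) (c • x + d • y) (c • x + d • y) (a • x + b • y) =
      (a * d - b * c) ^ 2 * R x y y x := by
  have h1 (z u) : R (a • x + b • y) (c • x + d • y) z u = (a * d - b * c) * R x y z u := by
    rw [h.add, h.smul, h.smul, h.add₂, h.add₂, h.smul₂, h.smul₂, h.smul₂, h.smul₂, h.self_left,
      h.self_left, h.swap_left y x]
    ring
  rw [h1, h.pair, h.swap_left, h1, h.swap_left, h.pair]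
  ring

/-- The bilinear form `(x, u) ↦ R(x, y, y, u)` of a curvature-like form `R`. -/
noncomputable def IsCurvatureLike.jacobiForm {R : V → V → V → V → ℝ} (h : IsCurvatureLike R)
    (y : V) : V →ₗ[ℝ] V →ₗ[ℝ] ℝ :=
  LinearMap.mk₂ ℝ (fun x u ↦ R x y y u) (fun _ _ _ ↦ h.add _ _ _ _ _) (fun _ _ _ ↦ h.smul _ _ _ _ _)
    (fun _ _ _ ↦ h.add₄ _ _ _ _ _) (fun _ _ _ ↦ h.smul₄ _ _ _ _ _)

end Algebraic

/-! ### Traces of bilinear forms over orthonormal bases -/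

section Trace

variable {V : Type*} [NormedAddCommGroup V] [InnerProductSpace ℝ V]
  {ι κ : Type*} [Fintype ι] [Fintype κ]

theorem sum_apply_self_eq (B : V →ₗ[ℝ] V →ₗ[ℝ] ℝ) (e : OrthonormalBasis ι ℝ V)
    (f : OrthonormalBasis κ ℝ V) : ∑ i, B (e i) (e i) = ∑ a, B (f a) (f a) := by
  calc ∑ i, B (e i) (e i) = ∑ i, ∑ a, inner ℝ (f a) (e i) * B (f a) (e i) := by
        refine Finset.sum_congr rfl fun i _ ↦ ?_
        have h : B (e i) = ∑ a, inner ℝ (f a) (e i) • B (f a) := by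
          conv_lhs => rw [← f.sum_repr' (e i)]
          simp
        simp [h, LinearMap.sum_apply]
    _ = ∑ a, ∑ i, inner ℝ (f a) (e i) * B (f a) (e i) := Finset.sum_comm
    _ = ∑ a, B (f a) (f a) := by
        refine Finset.sum_congr rfl fun a _ ↦ ?_
        conv_rhs => rw [← e.sum_repr' (f a), map_sum]
        simp [e.sum_repr' (f a), real_inner_comm]

/-- The coefficients of the `v i` in the basis form a skew matrix, and its contraction with a
symmetric one is zero. It is applied to the covariant derivatives of an orthonormal frame. -/
theorem sum_apply_eq_zero_of_skew (B : V →ₗ[ℝ] V →ₗ[ℝ] ℝ) (hB : ∀ x y, B x y = B y x)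
    (e : OrthonormalBasis ι ℝ V) (v : ι → V)
    (hv : ∀ i k, inner ℝ (v i) (e k) + inner ℝ (e i) (v k) = 0) : ∑ i, B (v i) (e i) = 0 := by
  have h1 : ∑ i, B (v i) (e i) = ∑ i, ∑ k, inner ℝ (e k) (v i) * B (e k) (e i) := by
    refine Finset.sum_congr rfl fun i _ ↦ ?_
    have h : B (v i) = ∑ k, inner ℝ (e k) (v i) • B (e k) := by
      conv_lhs => rw [← e.sum_repr' (v i)]
      simp
    simp [h, LinearMap.sum_apply]
  have h2 : ∑ i, ∑ k, inner ℝ (e k) (v i) * B (e k) (e i) =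
      -∑ i, ∑ k, inner ℝ (e k) (v i) * B (e k) (e i) := by
    conv_lhs => rw [Finset.sum_comm]
    simp only [← Finset.sum_neg_distrib]
    refine Finset.sum_congr rfl fun i _ ↦ Finset.sum_congr rfl fun k _ ↦ ?_
    rw [hB (e i)]
    linear_combination B (e k) (e i) * hv i k + B (e k) (e i) * real_inner_comm (v i) (e k)
  rw [h1]
  linarith

end Trace

/-! ### The derivative of the scalar curvature is the trace of ∇R -/

section ScalarCurvature

variable {E : Type*} [NormedAddCommGroup E] [NormedSpace ℝ E] [FiniteDimensional ℝ E]
  {H : Type*} [TopologicalSpace H] {I : ModelWithCorners ℝ E H}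
  {M : Type*} [TopologicalSpace M] [ChartedSpace H M] [IsManifold I ∞ M]
  [RiemannianBundle (fun x : M ↦ TangentSpace I x)]
  [IsContMDiffRiemannianBundle I ∞ E (fun x : M ↦ TangentSpace I x)]
  {p : M}

theorem scalarCurvature_eq_sum {ι : Type*} [Fintype ι]
    (b : OrthonormalBasis ι ℝ (TangentSpace I p)) :
    scalarCurvature I p = ∑ i, ∑ j, curvatureTensor p (b i) (b j) (b j) (b i) := by
  have h := isCurvatureLike_curvatureTensor (I := I) p
  let e := stdOrthonormalBasis ℝ (TangentSpace I p)
  have key (x : TangentSpace I p) : ∑ j, curvatureTensor p x (e j) (e j) x =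
      ∑ j, curvatureTensor p x (b j) (b j) x := by
    have hs (y : TangentSpace I p) : curvatureTensor p x y y x = h.jacobiForm x y y := by
      rw [h.swap_left, h.swap_right, neg_neg]
      rfl
    simp only [hs]
    exact sum_apply_self_eq _ e b
  calc scalarCurvature I p = ∑ i, ∑ j, curvatureTensor p (e i) (b j) (b j) (e i) :=
        Finset.sum_congr rfl fun i _ ↦ key (e i)
    _ = ∑ j, ∑ i, curvatureTensor p (e i) (b j) (b j) (e i) := Finset.sum_comm
    _ = ∑ j, ∑ i, curvatureTensor p (b i) (b j) (b j) (b i) :=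
        Finset.sum_congr rfl fun j _ ↦ sum_apply_self_eq (h.jacobiForm (b j)) e b
    _ = _ := Finset.sum_comm

theorem mvfderiv_sum_apply {ι : Type*} {s : Finset ι} {f : ι → M → ℝ}
    (hf : ∀ i ∈ s, SmoothNear I (f i) p) (v : TangentSpace I p) :
    mvfderiv I (fun q ↦ ∑ i ∈ s, f i q) p v = ∑ i ∈ s, mvfderiv I (f i) p v := by
  classical
  induction s using Finset.induction_on with
  | empty => simp [mvfderiv_const]
  | insert a s ha ih =>
    have hs : ∀ i ∈ s, SmoothNear I (f i) p := fun i hi ↦ hf i (by simp [hi])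
    simp only [Finset.sum_insert ha, ← ih hs]
    rw [mvfderiv_fun_add (hf a (by simp)).mdifferentiableAt (SmoothNear.sum hs).mdifferentiableAt,
      add_apply]

/-- Near `p`, τ is the double sum of R over a smooth orthonormal frame. Differentiating it gives the
trace of ∇R and terms containing ∇_w e_i; as ⟨e_i, e_k⟩ is constant, ∇_w e_i has skew coefficients
and these terms sum to zero. -/
theorem smoothNear_scalarCurvature (p : M) : SmoothNear I (scalarCurvature I) p ∧
    ∃ b : OrthonormalBasis (Fin (Module.finrank ℝ E)) ℝ (TangentSpace I p),
      ∀ w, mvfderiv I (scalarCurvature I) p w =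
        ∑ i, ∑ j, nablaCurvature p w (b i) (b j) (b j) (b i) := by
  obtain ⟨e, he, hon⟩ := exists_orthonormal_frame I p
  have hR (i j) : SmoothNear I (curvatureField (e i) (e j) (e j) (e i)) p :=
    (he i).curvatureField (he j) (he j) (he i)
  have hτ : scalarCurvature I =ᶠ[𝓝 p]
      fun q ↦ ∑ i, ∑ j, curvatureField (e i) (e j) (e j) (e i) q := by
    filter_upwards [hon, Filter.eventually_all.2 fun i ↦ (he i).eventually] with q hq heq
    obtain ⟨b, hb⟩ := exists_orthonormalBasis_eq hq
    rw [scalarCurvature_eq_sum b]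
    refine Finset.sum_congr rfl fun i _ ↦ Finset.sum_congr rfl fun j _ ↦ ?_
    rw [curvatureField_eq_curvatureTensor (heq i) (heq j) (heq j) (heq i), hb]
  obtain ⟨b, hb⟩ := exists_orthonormalBasis_eq hon.self_of_nhds
  refine ⟨(SmoothNear.sum fun i _ ↦ SmoothNear.sum fun j _ ↦ hR i j).congr hτ.symm, b,
    fun w ↦ ?_⟩
  have h := isCurvatureLike_curvatureTensor (I := I) p
  have hw : SmoothFieldNear (extend E w) p := .extend w
  have hbe (i) : e i p = b i := (congr_fun hb i).symm
  let v : Fin (Module.finrank ℝ E) → TangentSpace I p := fun i ↦ nabla (extend E w) (e i) p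
  have hskew (i k) : inner ℝ (v i) (b k) + inner ℝ (b i) (v k) = 0 := by
    have hc : (fun q ↦ (inner ℝ (e i q) (e k q) : ℝ)) =ᶠ[𝓝 p] fun _ ↦ if i = k then 1 else 0 := by
      filter_upwards [hon] with q hq using orthonormal_iff_ite.1 hq i k
    rw [← hbe, ← hbe, ← inner_nabla_add hw.mdifferentiableAt (he i).mdifferentiableAt
      (he k).mdifferentiableAt, mvfderiv_congr hc, mvfderiv_const, zero_apply]
  have hzero (j) : ∑ i, curvatureTensor p (v i) (b j) (b j) (b i) = 0 :=
    sum_apply_eq_zero_of_skew (h.jacobiForm (b j)) (fun x y ↦ h.reverse x (b j) (b j) y) b v hskew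
  -- By the symmetries of R the four correction terms are equal in pairs, hence the factors 2.
  have hterm (i j) : mvfderiv I (curvatureField (e i) (e j) (e j) (e i)) p w =
      nablaCurvature p w (b i) (b j) (b j) (b i)
        + 2 * curvatureTensor p (v i) (b j) (b j) (b i)
        + 2 * curvatureTensor p (v j) (b i) (b i) (b j) := by
    have h1 := nablaCurvatureField_eq hw (he i) (he j) (he j) (he i)
    rw [nablaCurvatureField_eq_nablaCurvature hw (he i) (he j) (he j) (he i)] at h1
    simp only [extend_apply_self, hbe] at h1
    change _ = _ - curvatureTensor p (v i) _ _ _ - curvatureTensor p _ (v j) _ _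
      - curvatureTensor p _ _ (v j) _ - curvatureTensor p _ _ _ (v i) at h1
    have h2 : curvatureTensor p (b i) (v j) (b j) (b i) =
        curvatureTensor p (v j) (b i) (b i) (b j) := by
      rw [h.swap_left, h.swap_right, neg_neg]
    rw [h2, h.pair (b i) (b j) (v j) (b i), h.reverse (b i) (b j) (b j) (v i)] at h1
    linarith
  rw [mvfderiv_congr hτ, mvfderiv_sum_apply fun i _ ↦ SmoothNear.sum fun j _ ↦ hR i j]
  simp only [mvfderiv_sum_apply fun j _ ↦ hR _ j, hterm, Finset.sum_add_distrib,
    ← Finset.mul_sum]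
  rw [Finset.sum_comm (f := fun i j ↦ curvatureTensor p (v i) (b j) (b j) (b i))]
  simp [hzero]

end ScalarCurvature

/-! ### The tensor Π(η), relative sectional curvature and the equivalence -/

section RelativeCurvature

variable {E : Type*} [NormedAddCommGroup E] [NormedSpace ℝ E] [FiniteDimensional ℝ E]
  {H : Type*} [TopologicalSpace H] {I : ModelWithCorners ℝ E H}
  {M : Type*} [TopologicalSpace M] [ChartedSpace H M] [IsManifold I ∞ M]
  [RiemannianBundle (fun x : M ↦ TangentSpace I x)]
  [IsContMDiffRiemannianBundle I ∞ E (fun x : M ↦ TangentSpace I x)]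
  {p : M} {η : Π p : M, TangentSpace I p →L[ℝ] ℝ} {k : M → ℝ}

/-- The coefficient 2 in Π is what the second Bianchi identity needs: in the cyclic sum 2α(w)π(x, y,
z, u) meets two terms α(w)π(y, x, z, u). The terms with α(z) and α(u) cancel by the first Bianchi
identity for π. -/
theorem isNablaCurvatureLike_tensorPi (α : TangentSpace I p →L[ℝ] ℝ) :
    IsNablaCurvatureLike (tensorPi α) where
  curvatureLike w :=
    { add := fun x x' y z u ↦ by
        simp only [tensorPi, metricPi, map_add, inner_add_left]; ring
      smul := fun c x y z u ↦ by
        simp only [tensorPi, metricPi, map_smul, inner_smul_left, smul_eq_mul, conj_trivial]; ring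
      swap_left := fun x y z u ↦ by simp only [tensorPi, metricPi]; ring
      swap_right := fun x y z u ↦ by simp only [tensorPi, metricPi]; ring
      pair := fun x y z u ↦ by
        simp only [tensorPi, metricPi]
        rw [real_inner_comm x u, real_inner_comm y z, real_inner_comm x z, real_inner_comm y u,
          real_inner_comm w u, real_inner_comm w z, real_inner_comm w y, real_inner_comm w x]
        ring
      bianchi := fun x y z u ↦ by
        simp only [tensorPi, metricPi]
        rw [real_inner_comm x y, real_inner_comm y z, real_inner_comm x z, real_inner_comm x w,
          real_inner_comm y w, real_inner_comm z w]
        ring }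
  add w w' x y z u := by
    simp only [tensorPi, metricPi, map_add, inner_add_left, inner_add_right]; ring
  smul c w x y z u := by
    simp only [tensorPi, metricPi, map_smul, inner_smul_left, inner_smul_right, smul_eq_mul,
      conj_trivial]
    ring
  bianchi w x y z u := by
    simp only [tensorPi, metricPi]
    rw [real_inner_comm x y, real_inner_comm w x, real_inner_comm w y]
    ring

theorem tensorPi_orthonormal {ι : Type*} [DecidableEq ι] {b : ι → TangentSpace I p}
    (hb : Orthonormal ℝ b)
    (α : TangentSpace I p →L[ℝ] ℝ) (w : TangentSpace I p) (i j : ι) :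
    tensorPi α w (b i) (b j) (b j) (b i) =
      if i = j then 0
      else 2 * α w + 2 * (inner ℝ (b i) w * α (b i) + inner ℝ (b j) w * α (b j)) := by
  split_ifs with hij
  · subst hij
    exact ((isNablaCurvatureLike_tensorPi α).curvatureLike w).self_left _ _ _
  · have h := orthonormal_iff_ite.1 hb
    have hji : j ≠ i := fun h ↦ hij h.symm
    simp only [tensorPi, metricPi, h, real_inner_comm (b i) w, real_inner_comm (b j) w, hij, hji,
      if_true, if_false]
    ring

/-- For z in the plane, ⟨x, z⟩α(x) + ⟨y, z⟩α(y) = α(z), so both halves of the general formula equal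
2α(z). This is the origin of the factor 1/4 in the theorem. -/
theorem tensorPi_orthonormal_of_eq {x y z : TangentSpace I p} (α : TangentSpace I p →L[ℝ] ℝ)
    (hxy : Orthonormal ℝ ![x, y]) (a c : ℝ) (hz : z = a • x + c • y) :
    tensorPi α z x y y x = 4 * α z := by
  have h := tensorPi_orthonormal hxy α z 0 1
  have hx : ‖x‖ = 1 := hxy.1 0
  have hy : ‖y‖ = 1 := hxy.1 1
  have h01 : (inner ℝ x y : ℝ) = 0 := hxy.2 zero_ne_one
  have h10 : (inner ℝ y x : ℝ) = 0 := hxy.2 one_ne_zero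
  simp only [Matrix.cons_val_zero, Matrix.cons_val_one, zero_ne_one, if_false] at h
  rw [h, hz]
  simp [inner_add_right, inner_smul_right, hx, hy, h01, h10]
  ring

theorem tensorPi_orthonormalBasis_plane {P : Submodule ℝ (TangentSpace I p)}
    (b : OrthonormalBasis (Fin 2) ℝ P) (α : TangentSpace I p →L[ℝ] ℝ) (Z : P) :
    tensorPi α (Z : TangentSpace I p) (b 0) (b 1) (b 1) (b 0) = 4 * α Z := by
  have hb : Orthonormal ℝ ![(b 0 : TangentSpace I p), (b 1 : TangentSpace I p)] := by
    convert b.orthonormal.comp_linearIsometry P.subtypeₗᵢ using 1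
    funext i
    fin_cases i <;> rfl
  refine tensorPi_orthonormal_of_eq α hb (b.repr Z 0) (b.repr Z 1) ?_
  conv_lhs => rw [← b.sum_repr Z]
  simp [Fin.sum_univ_two]

theorem HasPointwiseConstantRelativeCurvature.nablaCurvatureEq (hη : IsDirectedBy η)
    (h : HasPointwiseConstantRelativeCurvature η k) : NablaCurvatureEq η k := by
  intro p w x y z u
  have hT := (isNablaCurvatureLike_nablaCurvature (I := I) p).sub_mul
    (isNablaCurvatureLike_tensorPi (η p)) (1 / 4 * k p)
  refine sub_eq_zero.1 (hT.eq_zero (fun x y ↦ ?_) w x y z u)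
  by_cases hxy : LinearIndependent ℝ ![x, y]
  · let P : Submodule ℝ (TangentSpace I p) := Submodule.span ℝ (Set.range ![x, y])
    have hP : Module.finrank ℝ P = 2 := by simpa using finrank_span_eq_card hxy
    have hx : x ∈ P := Submodule.subset_span ⟨0, rfl⟩
    have hy : y ∈ P := Submodule.subset_span ⟨1, rfl⟩
    have hφ (Z : P) : sectionalOneForm P hP Z = k p * η p Z := by
      by_cases hΔ : P ≤ distribution η p
      · rw [hη.sectionalOneForm_eq_zero p P hP hΔ, show η p Z = 0 from hΔ Z.2, mul_zero]
      · exact h p P hP hΔ Z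
    -- This is the very basis used by `sectionalOneForm`, so independence of φ_P from the basis is
    -- not needed.
    let b : OrthonormalBasis (Fin 2) ℝ P := (stdOrthonormalBasis ℝ P).reindex (finCongr hP)
    have hzero (Z : P) : nablaCurvature p (Z : TangentSpace I p) (b 0) (b 1) (b 1) (b 0)
        - 1 / 4 * k p * tensorPi (η p) (Z : TangentSpace I p) (b 0) (b 1) (b 1) (b 0) = 0 := by
      rw [tensorPi_orthonormalBasis_plane,
        show nablaCurvature p (Z : TangentSpace I p) (b 0) (b 1) (b 1) (b 0) = _ from hφ Z]
      ring
    have hrepr (v : P) : (v : TangentSpace I p) =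
        b.repr v 0 • (b 0 : TangentSpace I p) + b.repr v 1 • (b 1 : TangentSpace I p) := by
      conv_lhs => rw [← b.sum_repr v]
      simp [Fin.sum_univ_two]
    have hdet := (hT.curvatureLike x).apply_pair (b.repr ⟨x, hx⟩ 0) (b.repr ⟨x, hx⟩ 1)
      (b.repr ⟨y, hy⟩ 0) (b.repr ⟨y, hy⟩ 1) (b 0) (b 1)
    rw [← hrepr ⟨x, hx⟩, ← hrepr ⟨y, hy⟩, hzero ⟨x, hx⟩, mul_zero] at hdet
    exact hdet
  -- For dependent x, y the form vanishes by linearity and skewness.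
  · have hc := hT.curvatureLike x
    rw [LinearIndependent.pair_iff] at hxy
    push Not at hxy
    obtain ⟨s, t, hst, hne⟩ := hxy
    rcases eq_or_ne s 0 with rfl | hs
    · have hy : y = (0 : ℝ) • x := by
        rw [zero_smul, zero_add, smul_eq_zero] at hst
        rw [zero_smul]
        exact hst.resolve_left (hne rfl)
      have h1 := hc.smul₂ 0 x x y x
      rw [← hy, zero_mul] at h1
      exact h1
    · have hx : x = (-(s⁻¹ * t)) • y := by
        rw [← inv_smul_smul₀ hs x, eq_neg_of_add_eq_zero_left hst]
        module
      have h1 := hc.smul (-(s⁻¹ * t)) y y y x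
      rw [← hx, hc.self_left, mul_zero] at h1
      exact h1

theorem NablaCurvatureEq.isRelativeSectionalCurvature (h : NablaCurvatureEq η k)
    (P : Submodule ℝ (TangentSpace I p)) (hP : Module.finrank ℝ P = 2) :
    IsRelativeSectionalCurvature η P hP (k p) := by
  intro Z
  rw [sectionalOneForm, h, tensorPi_orthonormalBasis_plane]
  ring

theorem IsRelativeSectionalCurvature.unique {P : Submodule ℝ (TangentSpace I p)}
    {hP : Module.finrank ℝ P = 2} {c c' : ℝ} (h : IsRelativeSectionalCurvature η P hP c)
    (h' : IsRelativeSectionalCurvature η P hP c') (hΔ : ¬ P ≤ distribution η p) : c = c' := by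
  obtain ⟨Z, hZ, hηZ⟩ := SetLike.not_le_iff_exists.1 hΔ
  exact mul_right_cancel₀ (b := η p Z) hηZ ((h ⟨Z, hZ⟩).symm.trans (h' ⟨Z, hZ⟩))

theorem hasPointwiseConstantRelativeCurvature_iff (hη : IsDirectedBy η) :
    HasPointwiseConstantRelativeCurvature η k ↔ NablaCurvatureEq η k :=
  ⟨fun h ↦ h.nablaCurvatureEq hη, fun h _ P hP _ ↦ h.isRelativeSectionalCurvature P hP⟩

theorem isPointwiseConstantRelativeCurvature_iff (hη : IsDirectedBy η) :
    IsPointwiseConstantRelativeCurvature η ↔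
      ∃ k : M → ℝ, HasPointwiseConstantRelativeCurvature η k := by
  constructor
  · intro h
    have hex (p : M) : ∃ c : ℝ, ∀ (P : Submodule ℝ (TangentSpace I p))
        (hP : Module.finrank ℝ P = 2), ¬ P ≤ distribution η p →
          IsRelativeSectionalCurvature η P hP c := by
      by_cases hne : ∃ (P : Submodule ℝ (TangentSpace I p)) (_ : Module.finrank ℝ P = 2),
          ¬ P ≤ distribution η p
      · obtain ⟨P, hP, hΔ⟩ := hne
        obtain ⟨c, hc⟩ := hη.exists_relativeSectionalCurvature p P hP hΔ
        refine ⟨c, fun P' hP' hΔ' ↦ ?_⟩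
        obtain ⟨c', hc'⟩ := hη.exists_relativeSectionalCurvature p P' hP' hΔ'
        rwa [h p P P' hP hP' c c' hΔ hΔ' hc hc']
      -- Without a plane outside Δ(p) the condition is empty and any number would do.
      · exact ⟨0, fun P hP hΔ ↦ (hne ⟨P, hP, hΔ⟩).elim⟩
    choose k hk using hex
    exact ⟨k, hk⟩
  · rintro ⟨k, hk⟩ p P P' hP hP' c c' hΔ hΔ' hc hc'
    rw [hc.unique (hk p P hP hΔ) hΔ, hc'.unique (hk p P' hP' hΔ') hΔ']

theorem sum_tensorPi {ι : Type*} [Fintype ι] (b : OrthonormalBasis ι ℝ (TangentSpace I p))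
    (α : TangentSpace I p →L[ℝ] ℝ) (w : TangentSpace I p) :
    ∑ i, ∑ j, tensorPi α w (b i) (b j) (b j) (b i) =
      2 * ((Fintype.card ι : ℝ) - 1) * ((Fintype.card ι : ℝ) + 2) * α w := by
  classical
  have hα : ∑ i, inner ℝ (b i) w * α (b i) = α w := by
    conv_rhs => rw [← b.sum_repr' w]
    simp
  -- The off-diagonal formula is summed over all i, j and its diagonal value subtracted. With N
  -- basis vectors this gives 2N² + 4N - 2N - 4 = 2(N - 1)(N + 2) times α(w).
  have hterm (i j : ι) : tensorPi α w (b i) (b j) (b j) (b i) =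
      2 * α w + 2 * (inner ℝ (b i) w * α (b i)) + 2 * (inner ℝ (b j) w * α (b j))
        - if i = j then 2 * α w + 4 * (inner ℝ (b i) w * α (b i)) else 0 := by
    rw [tensorPi_orthonormal b.orthonormal]
    split_ifs with hij
    · subst hij
      ring
    · ring
  simp only [hterm, Finset.sum_sub_distrib, Finset.sum_add_distrib, ← Finset.mul_sum, hα,
    Finset.sum_ite_eq, Finset.mem_univ, if_true, Finset.sum_const, Finset.card_univ, nsmul_eq_mul]
  simp only [mul_left_comm _ (Fintype.card ι : ℝ), ← Finset.mul_sum, hα]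
  ring

theorem NablaCurvatureEq.mvfderiv_scalarCurvature (h : NablaCurvatureEq η k) (p : M) :
    mvfderiv I (scalarCurvature I) p =
      (((Module.finrank ℝ E : ℝ) - 1) * ((Module.finrank ℝ E : ℝ) + 2) / 2 * k p) • η p := by
  obtain ⟨b, hb⟩ := (smoothNear_scalarCurvature (I := I) p).2
  ext w
  have hs := sum_tensorPi b (η p) w
  rw [Fintype.card_fin] at hs
  rw [hb]
  simp only [h p, ← Finset.mul_sum, hs, smul_apply, smul_eq_mul]
  ring

end RelativeCurvature

end RiemannianGeometry

theorem theorem2p4 {n : ℕ} {M : Type*} [TopologicalSpace M]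
    [ChartedSpace (EuclideanSpace ℝ (Fin n)) M] [IsManifold (𝓡 n) ∞ M]
    [RiemannianBundle (fun p : M ↦ TangentSpace (𝓡 n) p)]
    [IsContMDiffRiemannianBundle (𝓡 n) ∞ (EuclideanSpace ℝ (Fin n))
      (fun p : M ↦ TangentSpace (𝓡 n) p)]
    (η : Π p : M, TangentSpace (𝓡 n) p →L[ℝ] ℝ) (hη : IsDirectedBy η) :
    (IsPointwiseConstantRelativeCurvature η ↔ ∃ k : M → ℝ, NablaCurvatureEq η k) ∧
    ∀ k : M → ℝ,
      (HasPointwiseConstantRelativeCurvature η k ↔ NablaCurvatureEq η k) ∧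
      (HasPointwiseConstantRelativeCurvature η k →
        MDifferentiable (𝓡 n) 𝓘(ℝ, ℝ) (scalarCurvature (𝓡 n) : M → ℝ) ∧
        ∀ p : M, mvfderiv (𝓡 n) (scalarCurvature (𝓡 n)) p =
          (((n : ℝ) - 1) * ((n : ℝ) + 2) / 2 * k p) • η p) := by
  refine ⟨?_, fun k ↦ ⟨hasPointwiseConstantRelativeCurvature_iff hη, fun h ↦
    ⟨fun p ↦ (smoothNear_scalarCurvature p).1.mdifferentiableAt, fun p ↦ ?_⟩⟩⟩
  · simp only [isPointwiseConstantRelativeCurvature_iff hη,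
      hasPointwiseConstantRelativeCurvature_iff hη]
  · have hd := (h.nablaCurvatureEq hη).mvfderiv_scalarCurvature p
    rwa [finrank_euclideanSpace_fin] at hd
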